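/- Let $A,B\in \mathrm{M}_n(\mathbb Z)$ be non-singular matrices whose characteristic polynomials $h_A,h_B\in\mathbb Z[x]$ are irreducible. Put $G_A=\{A^{-k}\mathbf x \mid \mathbf x\in\mathbb Z^n,\ k\in\mathbb Z\}\subseteq\mathbb Q^n$ and $\mathcal R(A)=\mathbb Z[1/\det A]$, and similarly for $B$. Let $\mathcal P'(A)$ be the set of primes $p$ that divide $\det A$ and satisfy $h_A\not\equiv x^n \pmod p$, and let $t_p(A)$ be the multiplicity of $0$ as a root of $h_A$ modulo $p$. Assume that $\mathcal P'(A)\neq\emptyset$ and that $t_p(A)=n-1$ for every $p\in\mathcal P'(A)$. Let $K$ be a number field that contains all eigenvalues of $A$ and of $B$, with ring of integers $\mathcal O_K$. For an eigenvalue $\lambda\in \mathcal O_K$ of $A$ with an eigenvector $\mathbf u=(u_1,\dots,u_n)^t\in\mathbb Q(\lambda)^n$, let $I_{\mathcal R}(A,\lambda)=\mathcal R(A)u_1+\cdots+\mathcal R(A)u_n\subset K$, and define $I_{\mathcal R}(B,\mu)$ similarly, with $\mathcal R(B)$, for an eigenvalue $\mu\in\mathcal O_K$ of $B$. Write $[I_{\mathcal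 R}(A,\lambda)]=[I_{\mathcal R}(B,\mu)]$ if $I_{\mathcal R}(A,\lambda)=y\,I_{\mathcal R}(B,\mu)$ for some $y\in K^\times$; this does not depend on the choice of the eigenvectors. Then $G_A\cong G_B$ as abstract groups if and only if there are eigenvalues $\lambda,\mu\in\mathcal O_K$ of $A$ and $B$, respectively, such that $\lambda$ and $\mu$ have the same prime ideal divisors in $\mathcal O_K$ and $[I_{\mathcal R}(A,\lambda)]=[I_{\mathcal R}(B,\mu)]$. -/

import Mathlib

open scoped NumberField IntermediateField

/-- The vector of `K^n` with the integer coordinates `z`. -/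
def intVec {n : ℕ} (K : Type*) [Field K] (z : Fin n → ℤ) : Fin n → K := fun i => (z i : K)

/-- The matrix `A` with entries read in the field `K`. -/
def matOver {n : ℕ} (K : Type*) [Field K] (A : Matrix (Fin n) (Fin n) ℤ) :
    Matrix (Fin n) (Fin n) K := A.map (Int.castRingHom K)

theorem isUnit_det_matOver {n : ℕ} (A : Matrix (Fin n) (Fin n) ℤ) (hA : A.det ≠ 0) :
    IsUnit (matOver ℚ A).det := by
  have h : (matOver ℚ A).det = ((A.det : ℤ) : ℚ) := by
    simpa [matOver] using ((Int.castRingHom ℚ).map_det A).symm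
  rw [h, isUnit_iff_ne_zero]
  exact_mod_cast hA

theorem exists_common_exponent {n : ℕ} (A : Matrix (Fin n) (Fin n) ℤ) (hA : A.det ≠ 0)
    (k : ℤ) (z : Fin n → ℤ) (j : ℤ) (hkj : k ≤ j) :
    ∃ w : Fin n → ℤ,
      (matOver ℚ A ^ (-k)).mulVec (intVec ℚ z) = (matOver ℚ A ^ (-j)).mulVec (intVec ℚ w) := by
  obtain ⟨d, rfl⟩ := Int.le.dest hkj
  refine ⟨(A ^ d).mulVec z, ?_⟩
  have h1 : intVec ℚ ((A ^ d).mulVec z) = (matOver ℚ A ^ d).mulVec (intVec ℚ z) := by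
    have h2 : matOver ℚ A ^ d = (A ^ d).map (Int.castRingHom ℚ) := by
      simpa [matOver] using (map_pow (Int.castRingHom ℚ).mapMatrix A d).symm
    rw [h2]
    ext i
    simp [intVec, Matrix.mulVec, dotProduct]
  rw [h1, Matrix.mulVec_mulVec, ← zpow_natCast,
    ← Matrix.zpow_add (isUnit_det_matOver A hA)]
  congr 2
  ring

/-- The group `G_A = {A^{-k} x | x ∈ ℤ^n, k ∈ ℤ} ⊆ ℚ^n` of a non-singular integer matrix. -/
def groupG {n : ℕ} (A : Matrix (Fin n) (Fin n) ℤ) (hA : A.det ≠ 0) :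
    AddSubgroup (Fin n → ℚ) where
  carrier := {x | ∃ (k : ℤ) (z : Fin n → ℤ), x = (matOver ℚ A ^ (-k)).mulVec (intVec ℚ z)}
  zero_mem' := ⟨0, 0, by ext i; simp [intVec]⟩
  add_mem' := by
    rintro _ _ ⟨k, z, rfl⟩ ⟨l, w, rfl⟩
    obtain ⟨z', hz⟩ := exists_common_exponent A hA k z (max k l) (le_max_left _ _)
    obtain ⟨w', hw⟩ := exists_common_exponent A hA l w (max k l) (le_max_right _ _)
    refine ⟨max k l, z' + w', ?_⟩
    rw [hz, hw, ← Matrix.mulVec_add]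
    congr 1
    ext i
    simp [intVec]
  neg_mem' := by
    rintro _ ⟨k, z, rfl⟩
    refine ⟨k, -z, ?_⟩
    have h : intVec ℚ (-z) = -intVec ℚ z := by
      ext i
      simp [intVec]
    rw [h, Matrix.mulVec_neg]

/-- `t_p(A)`: the multiplicity of zero in the reduction modulo `p` of the characteristic
polynomial of `A`. -/
noncomputable def multZero {n : ℕ} (A : Matrix (Fin n) (Fin n) ℤ) (p : ℕ) : ℕ :=
  (A.charpoly.map (Int.castRingHom (ZMod p))).rootMultiplicity 0

/-- `𝒫(A)`: the prime divisors of `det A`. -/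
def primesP {n : ℕ} (A : Matrix (Fin n) (Fin n) ℤ) : Set ℕ :=
  {p | p.Prime ∧ (p : ℤ) ∣ A.det}

/-- `𝒫'(A)`: the `p ∈ 𝒫(A)` for which the characteristic polynomial of `A` is not congruent
to `X ^ n` modulo `p`. -/
def primesP' {n : ℕ} (A : Matrix (Fin n) (Fin n) ℤ) : Set ℕ :=
  {p | p ∈ primesP A ∧ A.charpoly.map (Int.castRingHom (ZMod p)) ≠ Polynomial.X ^ n}

/-- The ring `ℛ(A) = ℤ[1 / det A] ⊆ ℚ`. -/
noncomputable def ringR {n : ℕ} (A : Matrix (Fin n) (Fin n) ℤ) : Subalgebra ℤ ℚ :=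
  Algebra.adjoin ℤ {((A.det : ℤ) : ℚ)⁻¹}

section

variable {K : Type*} [Field K] [NumberField K] {n : ℕ}

/-- `u` is an eigenvector of `A` for the eigenvalue `a`, with coordinates in `ℚ(a)`. -/
def IsEigenvectorOver (A : Matrix (Fin n) (Fin n) ℤ) (a : K) (u : Fin n → K) : Prop :=
  Module.End.HasEigenvector (Matrix.toLin' (matOver K A)) a u ∧ ∀ i, u i ∈ ℚ⟮a⟯

/-- `I_ℤ(A, a) = {m₁ u₁ + ⋯ + m_n u_n | m_i ∈ ℤ}`, for an eigenvector `u`. -/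
def idealZ (u : Fin n → K) : Submodule ℤ K := Submodule.span ℤ (Set.range u)

/-- `I_ℛ(A, a) = I_ℤ(A, a) ⊗ ℛ(A)` as a subset of `K`, that is, the `ℛ(A)`-submodule of `K`
generated by `I_ℤ(A, a)`. -/
noncomputable def idealR (A : Matrix (Fin n) (Fin n) ℤ) (u : Fin n → K) : Submodule (ringR A) K :=
  Submodule.span (ringR A) (idealZ u : Set K)

/-- `[I_ℛ(A, a)] = [I_ℛ(B, b)]`, that is, `I_ℛ(A, a) = y I_ℛ(B, b)` for some `y ∈ K^×`.
When the characteristic polynomials are irreducible, the eigenvectors `u` and `v` are unique up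
to factors in `ℚ(a)^×` and `ℚ(b)^×`, so their choice does not matter. -/
def SameIdealClass (A B : Matrix (Fin n) (Fin n) ℤ) (a b : K) : Prop :=
  ∃ u v : Fin n → K, IsEigenvectorOver A a u ∧ IsEigenvectorOver B b v ∧
    ∃ y : K, y ≠ 0 ∧ (idealR A u : Set K) = (fun x => y * x) '' (idealR B v : Set K)

/-- `a` and `b` are divisible by the same (non-zero) prime ideals of the ring of integers. -/
def SamePrimeIdealDivisors (a b : 𝓞 K) : Prop :=
  ∀ P : Ideal (𝓞 K), P.IsPrime → P ≠ ⊥ → (P ∣ Ideal.span {a} ↔ P ∣ Ideal.span {b})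

end

/-! Everything rests on the shape of `G_A` at one prime `p` dividing `det A`. If `p ∈ 𝒫'(A)`, then
`h_A ≡ x^(n-1) (x - d)` modulo `p` with `d ≠ 0`, and Hensel's lemma lifts `d` to a unit root `c` in
`ℤ_p`. So `ℚ_p^n` splits into a line on which `A` acts by the unit `c` and a complement on which the
powers of `A` tend to zero (`exists_padic_projection`). Locally `G_A` is then `{x : |φ x| ≤ p^t}`
for a functional `φ` with `φ A = c φ`. For the other primes dividing `det A` the same holds with `φ
= 0`, and for primes not dividing `det A` the local group is `ℤ_p^n`.

An isomorphism `G_A ≅ G_B` is a rational matrix `T`, and `M = T⁻¹ B T` preserves `G_A`. Hence `φ M`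
is again a left eigenvector for `c`, so `φ (M A - A M) = 0`. Irreducibility makes the coordinates of
`φ` independent over `ℚ`, so `M` commutes with `A` (`commute_of_preserves_groupG`). A common
eigenvector then supplies `λ` and `μ`. Each divides a power of the other because powers of `A` are
integer multiples of `M` and conversely, while `T` and `T⁻¹` have entries in `ℛ(B)` and `ℛ(A)` and
so match the two modules.

Conversely, equal classes give a rational `S` carrying `u` to `y v`, and `M = S⁻¹ B S` has the
eigenvector `u` with eigenvalue `μ`. Equal prime divisors give `M^r = A D` and `A^s = M C` with `C`,
`D` integral over `ℤ`, hence with bounded powers. Therefore the local group of `M` is cut out by the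
same `φ`, only with another radius (`exists_padicOrbit_iff`). The radii differ at finitely many
primes, and one rational factor corrects them all. -/

/-! ### Irreducible characteristic polynomials and eigenvectors -/

open Matrix Polynomial in
-- The minimal polynomial of the restriction to `W` divides the irreducible `f.charpoly`, hence is
-- associated to it, and its degree is already the dimension of `V`.
theorem Submodule.eq_top_of_irreducible_charpoly {F V : Type*} [Field F] [AddCommGroup V]
    [Module F V] [FiniteDimensional F V] (f : V →ₗ[F] V) (hf : Irreducible f.charpoly)
    (W : Submodule F V) (hW : ∀ w ∈ W, f w ∈ W) (hne : W ≠ ⊥) : W = ⊤ := by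
  set g : W →ₗ[F] W := f.restrict hW with hg
  have key : ∀ (q : F[X]) (w : W), ((aeval g q w : W) : V) = aeval f q (w : V) := by
    intro q
    induction q using Polynomial.induction_on' with
    | add p q hp hq => intro w; simp [hp, hq]
    | monomial k a =>
      intro w
      rw [aeval_monomial, aeval_monomial]
      have : ∀ (k : ℕ) (w : W), (((g ^ k) w : W) : V) = (f ^ k) (w : V) := by
        intro k
        induction k with
        | zero => intro w; simp
        | succ k ih => intro w; rw [pow_succ, pow_succ, Module.End.mul_apply,
            Module.End.mul_apply, ih]; rfl
      simp [Algebra.algebraMap_eq_smul_one, this]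
  have hann : aeval g f.charpoly = 0 := by
    ext w
    rw [key, LinearMap.aeval_self_charpoly]
    simp
  have hnt : Nontrivial W := Submodule.nontrivial_iff_ne_bot.mpr hne
  have hint : IsIntegral F g := Algebra.IsIntegral.isIntegral g
  have h1 : Associated (minpoly F g) f.charpoly :=
    (hf.dvd_iff.mp (minpoly.dvd F g hann)).resolve_left (minpoly.not_isUnit F g) |>.symm
  have h2 : (minpoly F g).natDegree = Module.finrank F V := by
    rw [natDegree_eq_of_degree_eq (degree_eq_degree_of_associated h1), f.charpoly_natDegree]
  have h3 : (minpoly F g).natDegree ≤ Module.finrank F W := by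
    rw [← g.charpoly_natDegree]
    exact natDegree_le_of_dvd (minpoly.dvd F g g.aeval_self_charpoly) g.charpoly_monic.ne_zero
  exact Submodule.eq_top_of_finrank_eq (le_antisymm (Submodule.finrank_le W) (h2 ▸ h3))

section

variable {n : ℕ} (A : Matrix (Fin n) (Fin n) ℤ)

open Matrix

theorem irreducible_charpoly_matOver (h : Irreducible A.charpoly) :
    Irreducible (matOver ℚ A).charpoly := by
  have : (matOver ℚ A).charpoly = A.charpoly.map (Int.castRingHom ℚ) := charpoly_map _ _
  rw [this]
  exact (Polynomial.IsPrimitive.Int.irreducible_iff_irreducible_map_cast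
    A.charpoly_monic.isPrimitive).mp h

theorem matOver_transpose (L : Type*) [Field L] : matOver L Aᵀ = (matOver L A)ᵀ := rfl

theorem matOver_cast (L : Type*) [Field L] [CharZero L] :
    matOver L A = (matOver ℚ A).map (algebraMap ℚ L) := by
  ext i j; simp [matOver]

/-- The coordinates of an eigenvector of an integer matrix with irreducible characteristic
polynomial are linearly independent over `ℚ`. -/
theorem eq_zero_of_sum_eigenvector_eq_zero {L : Type*} [Field L] [CharZero L]
    (h : Irreducible A.charpoly) {c : L} {y : Fin n → L} (hy : y ≠ 0)
    (hA : matOver L A *ᵥ y = c • y) (r : Fin n → ℚ) (hr : ∑ i, (r i : L) * y i = 0) : r = 0 := by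
  let φ : (Fin n → ℚ) →ₗ[ℚ] L :=
    { toFun := fun r => ∑ i, (r i : L) * y i
      map_add' := fun a b => by simp [add_mul, Finset.sum_add_distrib]
      map_smul' := fun a b => by simp [Finset.mul_sum, mul_assoc, Algebra.smul_def] }
  have hφ : ∀ r, φ r = ∑ i, (r i : L) * y i := fun _ => rfl
  -- This makes the space of rational relations among the `y i` invariant under the transpose of
  -- `A`, hence zero or everything.
  have hstep : ∀ r, φ ((matOver ℚ A)ᵀ *ᵥ r) = c * φ r := by
    intro r
    have : ∀ i, ∑ j, matOver L A i j * y j = c * y i := fun i => congrFun hA i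
    simp only [hφ, mulVec, dotProduct, transpose_apply, Finset.mul_sum, mul_left_comm c, ← this]
    rw [Finset.sum_comm']
    pick_goal 3
    · exact Finset.univ
    pick_goal 3
    · exact fun _ => Finset.univ
    · refine Finset.sum_congr rfl fun j _ => ?_
      push_cast
      rw [Finset.sum_mul]
      refine Finset.sum_congr rfl fun i _ => ?_
      simp [matOver]; ring
    · simp
  by_contra hne
  have htop := Submodule.eq_top_of_irreducible_charpoly (Matrix.toLin' (matOver ℚ A)ᵀ)
    (by
      rw [Matrix.charpoly_toLin', Matrix.charpoly_transpose]
      exact irreducible_charpoly_matOver A h)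
    (LinearMap.ker φ)
    (fun w hw => by
      rw [LinearMap.mem_ker, toLin'_apply, hstep, LinearMap.mem_ker.mp hw, mul_zero])
    (fun hb => hne (by
      have : r ∈ LinearMap.ker φ := hr
      rwa [hb, Submodule.mem_bot] at this))
  apply hy
  ext i
  have : Pi.single i (1 : ℚ) ∈ LinearMap.ker φ := htop ▸ Submodule.mem_top
  rw [LinearMap.mem_ker, hφ, Finset.sum_eq_single i] at this
  · simpa using this
  · intro j _ hj; simp [hj]
  · simp

theorem eigenvector_eq_zero {L : Type*} [Field L] [CharZero L]
    (h : Irreducible A.charpoly) {c : L} {y : Fin n → L}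
    (hA : matOver L A *ᵥ y = c • y) (i : Fin n) (hi : y i = 0) : y = 0 := by
  by_contra hy
  have := eq_zero_of_sum_eigenvector_eq_zero A h hy hA (Pi.single i 1) (by
    rw [Finset.sum_eq_single i]
    · simp [hi]
    · intro j _ hj; simp [hj]
    · simp)
  simpa using congrFun this i

/-- Subtracting the right multiple of `y` kills coordinate `i`, and an eigenvector with a zero
coordinate vanishes. -/
theorem eigenvector_proportional {L : Type*} [Field L] [CharZero L]
    (h : Irreducible A.charpoly) {c : L} {y z : Fin n → L}
    (hy : matOver L A *ᵥ y = c • y) (hz : matOver L A *ᵥ z = c • z) (i : Fin n) (hi : y i ≠ 0) :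
    z = (z i / y i) • y := by
  have := eigenvector_eq_zero A h (c := c) (y := z - (z i / y i) • y)
    (by rw [mulVec_sub, mulVec_smul, hy, hz, smul_sub, smul_comm]) i (by simp [hi])
  exact sub_eq_zero.mp this

/-- A rational matrix is determined by its value at an eigenvector of `A`. -/
theorem matrix_eq_zero_of_mulVec_eigenvector {L : Type*} [Field L] [CharZero L] {m : Type*}
    (h : Irreducible A.charpoly) {c : L} {y : Fin n → L} (hy : y ≠ 0)
    (hA : matOver L A *ᵥ y = c • y) (M : Matrix m (Fin n) ℚ)
    (hM : M.map (algebraMap ℚ L) *ᵥ y = 0) : M = 0 := by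
  ext i j
  have := eq_zero_of_sum_eigenvector_eq_zero A h hy hA (M i) (by
    simpa [mulVec, dotProduct] using congrFun hM i)
  exact congrFun this j

theorem pos_of_irreducible_charpoly (h : Irreducible A.charpoly) : 0 < n := by
  rcases Nat.eq_zero_or_pos n with rfl | hn
  · exact absurd (by simp [Matrix.charpoly]) h.not_isUnit
  · exact hn

end

/-! ### Splitting off the unit eigenvalue over `ℤ_p` -/

section

open Matrix Polynomial

variable {p : ℕ} [Fact p.Prime]

theorem PadicInt.exists_eq_add_of_map_eq (f g : ℤ_[p][X])
    (h : f.map PadicInt.toZMod = g.map PadicInt.toZMod) :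
    ∃ q : ℤ_[p][X], f = g + C (p : ℤ_[p]) * q := by
  have : C (p : ℤ_[p]) ∣ f - g := by
    rw [C_dvd_iff_dvd_coeff]
    intro i
    rw [← Ideal.mem_span_singleton, ← PadicInt.maximalIdeal_eq_span_p, ← PadicInt.ker_toZMod,
      RingHom.mem_ker, ← coeff_map, Polynomial.map_sub, h, sub_self, coeff_zero]
  obtain ⟨q, hq⟩ := this
  exact ⟨q, by rw [← hq]; ring⟩

theorem PadicInt.isUnit_of_toZMod_ne_zero {x : ℤ_[p]} (h : PadicInt.toZMod x ≠ 0) : IsUnit x := by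
  by_contra hx
  apply h
  rw [← RingHom.mem_ker, PadicInt.ker_toZMod]
  exact (IsLocalRing.mem_maximalIdeal x).mpr hx

variable {n : ℕ} (A : Matrix (Fin n) (Fin n) ℤ)

theorem map_toZMod_charpoly :
    ((A.map (Int.castRingHom ℤ_[p])).charpoly).map PadicInt.toZMod =
      A.charpoly.map (Int.castRingHom (ZMod p)) := by
  rw [charpoly_map, Polynomial.map_map]
  congr 1
  exact RingHom.ext_int _ _

/-- Iterates one divisibility by `a`. With `a = p` it shows that high powers of `A` are divisible by
high powers of `p` on the image of `D`. -/
theorem exists_pow_mul_eq_smul {R : Type*} [CommRing R] {m : Type*} [Fintype m] [DecidableEq m]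
    (a : R) (A D G : Matrix m m R) (hc : Commute A G) (d : ℕ)
    (h : A ^ d * D = a • (G * D)) (j : ℕ) :
    A ^ (d * j) * D = a ^ j • (G ^ j * D) := by
  induction j with
  | zero => simp
  | succ j ih =>
    rw [mul_add, mul_one, pow_add, mul_assoc, h, mul_smul_comm, ← mul_assoc,
      ((hc.pow_left (d * j)).eq), mul_assoc, ih, mul_smul_comm, smul_smul, ← mul_assoc, pow_succ',
      pow_succ']

/-- Modulo `p` the characteristic polynomial is `X ^ (n - 1) * (X - d)` with `d ≠ 0`, so `d` is a
simple root and lifts by Hensel's lemma. The cofactor reduces to `X ^ (n - 1)`, whose value at `d`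
is nonzero. -/
theorem exists_simple_root (hn : 0 < n) (h0 : A.charpoly.map (Int.castRingHom (ZMod p)) ≠ X ^ n)
    (ht : multZero A p = n - 1) :
    ∃ (c : ℤ_[p]) (f : ℤ_[p][X]), IsUnit c ∧ IsUnit (f.eval c) ∧
      (A.map (Int.castRingHom ℤ_[p])).charpoly = (X - C c) * f ∧
      ∃ q, f = X ^ (n - 1) + C (p : ℤ_[p]) * q := by
  set hb := A.charpoly.map (Int.castRingHom (ZMod p)) with hbdef
  set H := (A.map (Int.castRingHom ℤ_[p])).charpoly with hH
  have hHb : H.map PadicInt.toZMod = hb := map_toZMod_charpoly A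
  have hmon : hb.Monic := A.charpoly_monic.map _
  have hdeg : hb.natDegree = n := by
    rw [hbdef, A.charpoly_monic.natDegree_map, charpoly_natDegree_eq_dim, Fintype.card_fin]
  obtain ⟨q, hq⟩ := pow_rootMultiplicity_dvd hb (0 : ZMod p)
  have hmu : hb.rootMultiplicity 0 = n - 1 := ht
  rw [hmu, C_0, sub_zero] at hq
  have hqm : q.Monic := (monic_X_pow (n - 1)).of_mul_monic_left (hq ▸ hmon)
  have hqd : q.natDegree = 1 := by
    have := (monic_X_pow (R := ZMod p) (n - 1)).natDegree_mul hqm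
    rw [← hq, hdeg, natDegree_X_pow] at this
    omega
  obtain ⟨d, hd⟩ : ∃ d, q = X - C d := ⟨-q.coeff 0, by
    rw [hqm.eq_X_add_C hqd]; simp⟩
  have hd0 : d ≠ 0 := by
    rintro rfl
    apply h0
    rw [hq, hd, C_0, sub_zero, ← pow_succ, Nat.sub_add_cancel hn]
  obtain ⟨a, ha⟩ : ∃ a : ℤ_[p], PadicInt.toZMod a = d := ⟨(d.val : ℤ_[p]), by simp⟩
  have ev : ∀ (g : ℤ_[p][X]) (x : ℤ_[p]), PadicInt.toZMod (g.eval x) =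
      (g.map PadicInt.toZMod).eval (PadicInt.toZMod x) := fun g x => by
    rw [eval_map, eval₂_at_apply]
  have h1 : PadicInt.toZMod (H.eval a) = 0 := by
    rw [ev, hHb, hq, hd, ha]; simp
  have h2 : IsUnit (H.derivative.eval a) := by
    apply PadicInt.isUnit_of_toZMod_ne_zero
    rw [ev, ← derivative_map, hHb, hq, hd, ha]
    simp [hd0]
  obtain ⟨c, hc, hca, -⟩ := hensels_lemma (F := H) (a := a) (by
    simp only [coe_aeval_eq_eval]
    rw [PadicInt.isUnit_iff.mp h2, one_pow]
    refine PadicInt.mem_nonunits.mp ?_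
    rw [← IsLocalRing.mem_maximalIdeal, ← PadicInt.ker_toZMod]
    exact h1)
  simp only [coe_aeval_eq_eval] at hc hca
  rw [PadicInt.isUnit_iff.mp h2] at hca
  have hcd : PadicInt.toZMod c = d := by
    rw [← ha, ← sub_eq_zero, ← map_sub, ← RingHom.mem_ker, PadicInt.ker_toZMod,
      IsLocalRing.mem_maximalIdeal]
    exact PadicInt.mem_nonunits.mpr hca
  have hcu : IsUnit c := PadicInt.isUnit_of_toZMod_ne_zero (hcd ▸ hd0)
  obtain ⟨f, hf⟩ := dvd_iff_isRoot.mpr hc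
  have hfb : f.map PadicInt.toZMod = X ^ (n - 1) := by
    have : (X - C d) * f.map PadicInt.toZMod = (X - C d) * X ^ (n - 1) := by
      have e := hHb
      rw [hf, Polynomial.map_mul, hq, hd] at e
      simp only [Polynomial.map_sub, map_X, map_C, hcd] at e
      rw [e, mul_comm]
    exact mul_left_cancel₀ (X_sub_C_ne_zero d) this
  refine ⟨c, f, hcu, ?_, hf, PadicInt.exists_eq_add_of_map_eq f (X ^ (n - 1)) (by simp [hfb])⟩
  apply PadicInt.isUnit_of_toZMod_ne_zero
  rw [ev, hfb, hcd]
  simp [hd0]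

/-- If zero is a root of multiplicity `n` or `n - 1` of the characteristic polynomial of `A`
modulo `p`, then some polynomial `P` in `A` projects `ℤ_p ^ n` to the part on which `A` is
invertible, and the powers of `A` tend to zero on the complement. -/
theorem exists_padic_projection (hn : 0 < n) (hp : (p : ℤ) ∣ A.det)
    (ht : p ∈ primesP' A → multZero A p = n - 1) :
    ∃ (P : Matrix (Fin n) (Fin n) ℤ_[p]) (c : ℤ_[p]), IsUnit c ∧
      A.map (Int.castRingHom ℤ_[p]) * P = c • P ∧
      P * A.map (Int.castRingHom ℤ_[p]) = c • P ∧
      (∀ j : ℕ, ∃ (k : ℕ) (Q : Matrix (Fin n) (Fin n) ℤ_[p]),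
        A.map (Int.castRingHom ℤ_[p]) ^ k * (1 - P) = (p : ℤ_[p]) ^ j • Q) ∧
      (p ∈ primesP' A → P ≠ 0) := by
  set A' := A.map (Int.castRingHom ℤ_[p]) with hA'
  have hmem : p ∈ primesP' A ↔ A.charpoly.map (Int.castRingHom (ZMod p)) ≠ X ^ n :=
    ⟨fun h => h.2, fun h => ⟨⟨Fact.out, hp⟩, h⟩⟩
  have hCH : aeval A' A'.charpoly = 0 := aeval_self_charpoly A'
  have hcomm : ∀ g : ℤ_[p][X], Commute A' (aeval A' g) := fun g => by
    have := (Commute.all (X : ℤ_[p][X]) g).map (aeval A')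
    rwa [aeval_X] at this
  by_cases h0 : p ∈ primesP' A
  · obtain ⟨c, f, hc, hfc, hf, q, hq⟩ := exists_simple_root A hn (hmem.mp h0) (ht h0)
    -- The projection is `f(A') / f(c)`. By Cayley–Hamilton, `(A' - c) f(A') = 0`.
    obtain ⟨u, hu⟩ := hfc.exists_left_inv
    have hAf : A' * aeval A' f = c • aeval A' f := by
      rw [hf, map_mul, map_sub, aeval_X, aeval_C, sub_mul, sub_eq_zero] at hCH
      rw [hCH, Algebra.smul_def]
    have hPf : u • aeval A' f = aeval A' (C u * f) := by
      rw [map_mul, aeval_C, Algebra.smul_def]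
    have hAP : A' * (u • aeval A' f) = c • (u • aeval A' f) := by
      rw [mul_smul_comm, hAf, smul_comm]
    refine ⟨u • aeval A' f, c, hc, hAP, ?_, ?_, ?_⟩
    · rw [hPf, ← (hcomm _).eq, ← hPf, hAP]
    -- `1 - f / f(c)` is divisible by `X - c`, so its product with `f` is a multiple of the
    -- characteristic polynomial. Since `f ≡ X ^ (n - 1)`, this says that `A' ^ (n - 1)` is
    -- divisible by `p` on the complement.
    · have hz : aeval A' f * (1 - u • aeval A' f) = 0 := by
        obtain ⟨r, hr⟩ := X_sub_C_dvd_sub_C_eval (a := c) (p := f)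
        have e1 : 1 - u • aeval A' f = - aeval A' (C u * ((X - C c) * r)) := by
          rw [← hr, hPf]
          have : C u * C (f.eval c) = (1 : ℤ_[p][X]) := by rw [← C_mul, hu, C_1]
          rw [mul_sub, this, map_sub, map_one, neg_sub]
        rw [e1, ← map_neg, ← map_mul]
        have e2 : f * -(C u * ((X - C c) * r)) = A'.charpoly * (-(C u * r)) := by rw [hf]; ring
        rw [e2, map_mul, hCH, zero_mul]
      intro j
      refine ⟨(n - 1) * j, _, exists_pow_mul_eq_smul _ A' _ (-aeval A' q) (hcomm q).neg_right
        (n - 1) ?_ j⟩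
      generalize 1 - u • aeval A' f = D at hz ⊢
      rw [hq, map_add, map_mul, aeval_C, map_pow, aeval_X, add_mul] at hz
      rw [eq_neg_of_add_eq_zero_left hz, neg_mul, smul_neg, mul_assoc,
        ← Algebra.smul_def]
    -- If `P` vanished, so would `f(A')`; then `A` would be nilpotent modulo `p`, with
    -- characteristic polynomial `X ^ n`.
    · intro _ hP
      have hz : aeval A' f = 0 := by
        have : (f.eval c) • (u • aeval A' f) = aeval A' f := by
          rw [smul_smul, mul_comm, hu, one_smul]
        rw [← this, hP, smul_zero]
      rw [hq, map_add, map_mul, aeval_C, map_pow, aeval_X, ← Algebra.smul_def] at hz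
      have hz' : (A.map (Int.castRingHom (ZMod p))) ^ (n - 1) = 0 := by
        have e := congrArg (PadicInt.toZMod (p := p)).mapMatrix hz
        rw [map_add, map_pow, map_zero] at e
        have e3 : (PadicInt.toZMod (p := p)).mapMatrix A' = A.map (Int.castRingHom (ZMod p)) := by
          rw [hA', RingHom.mapMatrix_apply, Matrix.map_map]
          ext i j
          simp
        have e4 : (PadicInt.toZMod (p := p)).mapMatrix ((p : ℤ_[p]) • aeval A' q) = 0 := by
          ext i j
          simp
        rwa [e3, e4, add_zero] at e
      have := isNilpotent_charpoly_sub_pow_of_isNilpotent ⟨n - 1, hz'⟩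
      have := sub_eq_zero.mp this.eq_zero
      rw [charpoly_map, Fintype.card_fin] at this
      exact hmem.mp h0 this
  -- Here there is no unit part: `P = 0`, the value of `c` is immaterial, and Cayley–Hamilton gives
  -- `A' ^ n = -p q(A')`.
  · refine ⟨0, 1, isUnit_one, by simp, by simp, ?_, fun h => absurd h h0⟩
    have hb : A.charpoly.map (Int.castRingHom (ZMod p)) = X ^ n := by
      by_contra h; exact h0 (hmem.mpr h)
    obtain ⟨q, hq⟩ := PadicInt.exists_eq_add_of_map_eq A'.charpoly (X ^ n)
      (by rw [map_toZMod_charpoly, hb]; simp)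
    intro j
    refine ⟨n * j, _, exists_pow_mul_eq_smul _ A' _ (-aeval A' q) (hcomm q).neg_right n ?_ j⟩
    rw [hq, map_add, map_mul, aeval_C, map_pow, aeval_X, ← Algebra.smul_def] at hCH
    rw [sub_zero, mul_one, mul_one, eq_neg_of_add_eq_zero_left hCH, smul_neg]

end

/-! ### Local groups over `ℚ_p` -/

section

open Matrix Polynomial

variable {p : ℕ} [Fact p.Prime] {n : ℕ}

/-- The form of `exists_padic_projection` over the field `ℚ_p`. -/
theorem exists_rational_projection (A : Matrix (Fin n) (Fin n) ℤ) (hn : 0 < n)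
    (hp : (p : ℤ) ∣ A.det) (ht : p ∈ primesP' A → multZero A p = n - 1) :
    ∃ (P : Matrix (Fin n) (Fin n) ℚ_[p]) (c : ℚ_[p]), ‖c‖ = 1 ∧
      (∀ i j, ‖P i j‖ ≤ 1) ∧
      matOver ℚ_[p] A * P = c • P ∧
      P * matOver ℚ_[p] A = c • P ∧
      (∀ j : ℕ, ∃ (k : ℕ) (Q : Matrix (Fin n) (Fin n) ℚ_[p]), (∀ i j, ‖Q i j‖ ≤ 1) ∧
        matOver ℚ_[p] A ^ k * (1 - P) = (p : ℚ_[p]) ^ j • Q) ∧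
      (p ∈ primesP' A → P ≠ 0) := by
  obtain ⟨P, c, hc, hAP, hPA, hk, hP⟩ := exists_padic_projection A hn hp ht
  set φ := (PadicInt.Coe.ringHom (p := p)).mapMatrix (m := Fin n) with hφ
  have happ : ∀ M i j, φ M i j = (M i j : ℚ_[p]) := fun _ _ _ => rfl
  have hA : φ (A.map (Int.castRingHom ℤ_[p])) = matOver ℚ_[p] A := by
    ext i j
    simp [hφ, matOver]
  have hsm : ∀ (a : ℤ_[p]) M, φ (a • M) = (a : ℚ_[p]) • φ M := fun a M => by
    ext i j
    rw [Matrix.smul_apply, happ, happ, Matrix.smul_apply, smul_eq_mul, smul_eq_mul, PadicInt.coe_mul]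
  have hint : ∀ M i j, ‖φ M i j‖ ≤ 1 := fun M i j => (M i j).2
  refine ⟨φ P, c, ?_, hint P, ?_, ?_, ?_, ?_⟩
  · rw [← PadicInt.norm_def, PadicInt.isUnit_iff.mp hc]
  · rw [← hA, ← map_mul, hAP, hsm]
  · rw [← hA, ← map_mul, hPA, hsm]
  · intro j
    obtain ⟨k, Q, h⟩ := hk j
    refine ⟨k, φ Q, hint Q, ?_⟩
    rw [← hA, ← map_pow, ← map_one φ, ← map_sub, ← map_mul, h, hsm]
    simp
  · intro h h0
    apply hP h
    ext i j
    have := congrFun (congrFun h0 i) j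
    simpa [happ] using this

theorem norm_mulVec_le {M : Matrix (Fin n) (Fin n) ℚ_[p]} (hM : ∀ i j, ‖M i j‖ ≤ 1)
    (x : Fin n → ℚ_[p]) : ‖M *ᵥ x‖ ≤ ‖x‖ := by
  rw [pi_norm_le_iff_of_nonneg (norm_nonneg _)]
  intro i
  change ‖∑ j, M i j * x j‖ ≤ ‖x‖
  refine IsUltrametricDist.norm_sum_le_of_forall_le_of_nonneg (norm_nonneg _) fun j _ => ?_
  rw [norm_mul]
  exact (mul_le_of_le_one_left (norm_nonneg _) (hM i j)).trans (norm_le_pi_norm x j)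

theorem exists_norm_mulVec_le (M : Matrix (Fin n) (Fin n) ℚ_[p]) :
    ∃ b : ℝ, 0 ≤ b ∧ ∀ x, ‖M *ᵥ x‖ ≤ b * ‖x‖ :=
  ⟨‖(Matrix.toLin' M).toContinuousLinearMap‖, norm_nonneg _, fun x =>
    (Matrix.toLin' M).toContinuousLinearMap.le_opNorm x⟩

theorem norm_vec_add_le_of_le {x y : Fin n → ℚ_[p]} {r : ℝ} (hx : ‖x‖ ≤ r) (hy : ‖y‖ ≤ r) :
    ‖x + y‖ ≤ r := by
  rw [pi_norm_le_iff_of_nonneg ((norm_nonneg _).trans hx)]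
  intro i
  exact (Padic.nonarchimedean _ _).trans
    (max_le ((norm_le_pi_norm x i).trans hx) ((norm_le_pi_norm y i).trans hy))

/-- The vectors that some power of `M` moves into the lattice of all `x` with `S x` integral. -/
def padicOrbit (S M : Matrix (Fin n) (Fin n) ℚ_[p]) : Set (Fin n → ℚ_[p]) :=
  {x | ∃ k : ℕ, ‖S *ᵥ (M ^ k *ᵥ x)‖ ≤ 1}

/-- In the coordinates given by `S`, a further step of `M` acts through the integral matrix `N` and
cannot increase the norm. -/
theorem padicOrbit_of_le {S M N : Matrix (Fin n) (Fin n) ℚ_[p]} (hSM : S * M = N * S)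
    (hN : ∀ i j, ‖N i j‖ ≤ 1) {x : Fin n → ℚ_[p]} {k l : ℕ} (hkl : k ≤ l)
    (h : ‖S *ᵥ (M ^ k *ᵥ x)‖ ≤ 1) : ‖S *ᵥ (M ^ l *ᵥ x)‖ ≤ 1 := by
  induction l, hkl using Nat.le_induction with
  | base => exact h
  | succ l _ ih =>
    rw [pow_succ', ← mulVec_mulVec, mulVec_mulVec _ S M, hSM, ← mulVec_mulVec]
    exact (norm_mulVec_le hN _).trans ih

theorem padicOrbit_add {S M N : Matrix (Fin n) (Fin n) ℚ_[p]} (hSM : S * M = N * S)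
    (hN : ∀ i j, ‖N i j‖ ≤ 1) {x y : Fin n → ℚ_[p]} (hx : x ∈ padicOrbit S M)
    (hy : y ∈ padicOrbit S M) : x + y ∈ padicOrbit S M := by
  obtain ⟨k, hk⟩ := hx
  obtain ⟨l, hl⟩ := hy
  refine ⟨max k l, ?_⟩
  rw [mulVec_add, mulVec_add]
  exact norm_vec_add_le_of_le (padicOrbit_of_le hSM hN (le_max_left _ _) hk)
    (padicOrbit_of_le hSM hN (le_max_right _ _) hl)

theorem padicOrbit_smul {S M : Matrix (Fin n) (Fin n) ℚ_[p]} {s : ℚ_[p]} (hs : ‖s‖ ≤ 1)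
    {x : Fin n → ℚ_[p]} (hx : x ∈ padicOrbit S M) : s • x ∈ padicOrbit S M := by
  obtain ⟨k, hk⟩ := hx
  refine ⟨k, ?_⟩
  rw [mulVec_smul, mulVec_smul, norm_smul]
  exact mul_le_one₀ hs (norm_nonneg _) hk

theorem padicOrbit_smul_iff {S M : Matrix (Fin n) (Fin n) ℚ_[p]} {s : ℚ_[p]} (hs : ‖s‖ = 1)
    {x : Fin n → ℚ_[p]} : s • x ∈ padicOrbit S M ↔ x ∈ padicOrbit S M := by
  refine ⟨fun h => ?_, padicOrbit_smul hs.le⟩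
  have hs0 : s ≠ 0 := by rintro rfl; simp at hs
  have := padicOrbit_smul (s := s⁻¹) (by rw [norm_inv, hs, inv_one]) h
  rwa [smul_smul, inv_mul_cancel₀ hs0, one_smul] at this

/-- Matrices whose powers are uniformly bounded. -/
def PowerBounded (D : Matrix (Fin n) (Fin n) ℚ_[p]) : Prop :=
  ∃ b : ℝ, 0 ≤ b ∧ ∀ (k : ℕ) x, ‖D ^ k *ᵥ x‖ ≤ b * ‖x‖

theorem exists_pow_mul_le_one (b : ℝ) : ∃ j : ℕ, b * ‖(p : ℚ_[p]) ^ j‖ ≤ 1 := by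
  have h1 : ‖(p : ℚ_[p])‖ < 1 := Padic.norm_p_lt_one
  rcases le_or_gt b 0 with hb | hb
  · exact ⟨0, by simp; linarith⟩
  · obtain ⟨j, hj⟩ := exists_pow_lt_of_lt_one (inv_pos.mpr hb) h1
    refine ⟨j, ?_⟩
    rw [norm_pow]
    calc b * ‖(p : ℚ_[p])‖ ^ j ≤ b * b⁻¹ := by gcongr
      _ = 1 := mul_inv_cancel₀ hb.ne'

/-- Over `ℚ_p`, the group attached to `M` and a lattice is the preimage of a ball under a
functional that depends only on the part on which `A` is invertible. -/
theorem exists_padicOrbit_iff {A P M S S' N C D : Matrix (Fin n) (Fin n) ℚ_[p]} {c : ℚ_[p]}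
    (hc : ‖c‖ = 1) (hPA : P * A = c • P)
    (hk : ∀ j : ℕ, ∃ (k : ℕ) (Q : Matrix (Fin n) (Fin n) ℚ_[p]), (∀ i j, ‖Q i j‖ ≤ 1) ∧
        A ^ k * (1 - P) = (p : ℚ_[p]) ^ j • Q)
    (hS : S' * S = 1) (hSM : S * M = N * S) (hN : ∀ i j, ‖N i j‖ ≤ 1)
    (hAD : Commute A D) (hMC : Commute M C)
    {r s : ℕ} (hr : M ^ r = A * D) (hs : A ^ s = M * C)
    (hC : PowerBounded C) (hD : PowerBounded D) (φ : (Fin n → ℚ_[p]) →ₗ[ℚ_[p]] ℚ_[p])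
    (hφ : ∀ x, φ x = 0 ↔ P *ᵥ x = 0) (hφb : ∀ x, ‖φ x‖ ≤ ‖P *ᵥ x‖) :
    ∃ t : ℤ, ∀ x, x ∈ padicOrbit S M ↔ ‖φ x‖ ≤ (p : ℝ) ^ t := by
  obtain ⟨bS, hbS, hS1⟩ := exists_norm_mulVec_le S
  obtain ⟨bS', hbS', hS1'⟩ := exists_norm_mulVec_le S'
  obtain ⟨bP, hbP, hP1⟩ := exists_norm_mulVec_le P
  obtain ⟨bC, hbC, hC1⟩ := hC
  obtain ⟨bD, hbD, hD1⟩ := hD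
  -- On the kernel of `P` the vectors `A ^ k x` become arbitrarily small, and `M ^ (r * k) = D ^ k *
  -- A ^ k` loses only the bounded factor `D ^ k`.
  have hker : ∀ x, φ x = 0 → x ∈ padicOrbit S M := by
    intro x hx
    rw [hφ] at hx
    obtain ⟨j, hj⟩ := exists_pow_mul_le_one (p := p) (bS * (bD * ‖x‖))
    obtain ⟨k, Q, hQ, hkQ⟩ := hk j
    have hA : A ^ k *ᵥ x = (p : ℚ_[p]) ^ j • (Q *ᵥ x) := by
      rw [← smul_mulVec, ← hkQ, ← mulVec_mulVec, sub_mulVec, hx, one_mulVec, sub_zero]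
    refine ⟨r * k, ?_⟩
    rw [pow_mul, hr, hAD.mul_pow, (hAD.pow_pow k k).eq, ← mulVec_mulVec, hA]
    calc _ ≤ bS * (bD * (‖(p : ℚ_[p]) ^ j‖ * ‖x‖)) := by
          refine (hS1 _).trans (mul_le_mul_of_nonneg_left ((hD1 k _).trans ?_) hbS)
          rw [norm_smul]
          gcongr
          exact norm_mulVec_le hQ x
      _ = bS * (bD * ‖x‖) * ‖(p : ℚ_[p]) ^ j‖ := by ring
      _ ≤ 1 := hj
  -- `P A ^ l = c ^ l P` with `‖c‖ = 1`, so `‖P x‖` can be computed from `A ^ (s * k) x = C ^ k M ^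
  -- k x`, where `M ^ k x` lies in a bounded lattice.
  have hbd : ∀ x ∈ padicOrbit S M, ‖φ x‖ ≤ bP * (bC * (bS' * 1)) := by
    rintro x ⟨k, hx⟩
    refine (hφb x).trans ?_
    have h1 : M ^ k *ᵥ x = S' *ᵥ (S *ᵥ (M ^ k *ᵥ x)) := by
      rw [mulVec_mulVec _ S', hS, one_mulVec]
    have h2 : P * A ^ (s * k) = c ^ (s * k) • P := by
      generalize s * k = l
      induction l with
      | zero => simp
      | succ l ih => rw [pow_succ, ← mul_assoc, ih, smul_mul_assoc, hPA, smul_smul, pow_succ]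
    have h3 : ‖P *ᵥ x‖ = ‖P *ᵥ (C ^ k *ᵥ (M ^ k *ᵥ x))‖ := by
      rw [mulVec_mulVec _ (C ^ k), ← (hMC.pow_pow k k).eq, ← hMC.mul_pow, ← hs, ← pow_mul,
        mulVec_mulVec, h2, smul_mulVec, norm_smul, norm_pow, hc, one_pow, one_mul]
    rw [h3]
    refine (hP1 _).trans (mul_le_mul_of_nonneg_left ((hC1 k _).trans ?_) hbP)
    rw [h1]
    gcongr
    exact (hS1' _).trans (by gcongr)
  have hp1 : (1 : ℝ) < p := by exact_mod_cast (Fact.out : p.Prime).one_lt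
  by_cases h0 : ∀ x, φ x = 0
  · exact ⟨0, fun x => ⟨fun _ => by simp [h0 x], fun _ => hker x (h0 x)⟩⟩
  push Not at h0
  obtain ⟨x₀, hx₀⟩ := h0
  have hval : ∀ x, φ x ≠ 0 → ∃ t : ℤ, ‖φ x‖ = (p : ℝ) ^ t := fun x hx =>
    ⟨_, Padic.norm_eq_zpow_neg_valuation hx⟩
  -- The norms take discrete values and are bounded on the orbit, so a largest one `p ^ t` is
  -- attained at some `x`. Any `z` with `‖φ z‖ ≤ p ^ t` is an integral multiple of this `x` plus a
  -- vector killed by `φ`.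
  obtain ⟨t, ⟨x, hx, hxt⟩, hmax⟩ := Int.exists_greatest_of_bdd
    (P := fun t : ℤ => ∃ x ∈ padicOrbit S M, ‖φ x‖ = (p : ℝ) ^ t)
    (by
      obtain ⟨m, hm⟩ := pow_unbounded_of_one_lt (bP * (bC * (bS' * 1))) hp1
      refine ⟨m, ?_⟩
      rintro t ⟨x, hx, ht⟩
      have := (hbd x hx).trans hm.le
      rw [ht, ← zpow_natCast] at this
      exact (zpow_le_zpow_iff_right₀ hp1).mp this)
    (by
      obtain ⟨j, hj⟩ := exists_pow_mul_le_one (p := p) (bS * ‖x₀‖)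
      obtain ⟨t, ht⟩ := hval ((p : ℚ_[p]) ^ j • x₀) (by
        rw [map_smul]
        exact smul_ne_zero (pow_ne_zero _ (by
          exact_mod_cast (Fact.out : p.Prime).ne_zero)) hx₀)
      refine ⟨t, _, ⟨0, ?_⟩, ht⟩
      rw [pow_zero, one_mulVec]
      refine (hS1 _).trans ?_
      rw [norm_smul]
      linarith)
  refine ⟨t, fun z => ⟨fun hz => ?_, fun hz => ?_⟩⟩
  · by_cases hz0 : φ z = 0
    · rw [hz0, norm_zero]; positivity
    · obtain ⟨t', ht'⟩ := hval z hz0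
      rw [ht']
      exact (zpow_le_zpow_iff_right₀ hp1).mpr (hmax t' ⟨z, hz, ht'⟩)
  · have hx0 : φ x ≠ 0 := by
      rw [← norm_pos_iff, hxt]; positivity
    have h1 : φ (z - (φ z / φ x) • x) = 0 := by
      rw [map_sub, map_smul, smul_eq_mul, div_mul_cancel₀ _ hx0, sub_self]
    have h2 : ‖φ z / φ x‖ ≤ 1 := by
      rw [norm_div, hxt]
      exact div_le_one_of_le₀ hz (by positivity)
    have := padicOrbit_add hSM hN (hker _ h1) (padicOrbit_smul h2 hx)
    rwa [sub_add_cancel] at this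

end

/-! ### From local to global, denominators, and the ring `ℛ(A)` -/

section

open Matrix Polynomial

variable {n : ℕ}

/-- A rational vector with coordinates read in the field `L`. -/
def castVec (L : Type*) [Field L] (x : Fin n → ℚ) : Fin n → L := fun i => (x i : L)

/-- A rational matrix with entries read in the field `L`. -/
def castMat (L : Type*) [Field L] [CharZero L] :
    Matrix (Fin n) (Fin n) ℚ →+* Matrix (Fin n) (Fin n) L := (algebraMap ℚ L).mapMatrix

theorem castMat_apply (L : Type*) [Field L] [CharZero L] (M : Matrix (Fin n) (Fin n) ℚ)
    (i j : Fin n) : castMat L M i j = (M i j : L) := by simp [castMat]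

theorem castMat_matOver (L : Type*) [Field L] [CharZero L] (A : Matrix (Fin n) (Fin n) ℤ) :
    castMat L (matOver ℚ A) = matOver L A := (matOver_cast A L).symm

theorem castVec_mulVec (L : Type*) [Field L] [CharZero L] (M : Matrix (Fin n) (Fin n) ℚ)
    (x : Fin n → ℚ) : castVec L (M *ᵥ x) = castMat L M *ᵥ castVec L x := by
  ext i
  simp [castVec, mulVec, dotProduct, castMat_apply]

theorem matOver_mul (L : Type*) [Field L] (A B : Matrix (Fin n) (Fin n) ℤ) :
    matOver L (A * B) = matOver L A * matOver L B :=
  map_mul (Int.castRingHom L).mapMatrix A B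

theorem matOver_pow (L : Type*) [Field L] (A : Matrix (Fin n) (Fin n) ℤ) (k : ℕ) :
    matOver L (A ^ k) = matOver L A ^ k :=
  map_pow (Int.castRingHom L).mapMatrix A k

theorem intVec_mulVec (A : Matrix (Fin n) (Fin n) ℤ) (z : Fin n → ℤ) :
    intVec ℚ (A *ᵥ z) = matOver ℚ A *ᵥ intVec ℚ z := by
  ext i
  simp [intVec, matOver, mulVec, dotProduct]

theorem det_matOver (A : Matrix (Fin n) (Fin n) ℤ) : (matOver ℚ A).det = (A.det : ℚ) := by
  simpa [matOver] using ((Int.castRingHom ℚ).map_det A).symm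

theorem mem_groupG_iff (A : Matrix (Fin n) (Fin n) ℤ) (hA : A.det ≠ 0) (x : Fin n → ℚ) :
    x ∈ groupG A hA ↔ ∃ (k : ℕ) (z : Fin n → ℤ), matOver ℚ A ^ k *ᵥ x = intVec ℚ z := by
  have hu := isUnit_det_matOver A hA
  have hinv : ∀ k : ℕ, matOver ℚ A ^ k * matOver ℚ A ^ (-(k : ℤ)) = 1 ∧
      matOver ℚ A ^ (-(k : ℤ)) * matOver ℚ A ^ k = 1 := fun k => by
    rw [← zpow_natCast, ← Matrix.zpow_add hu, ← Matrix.zpow_add hu]; simp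
  constructor
  · rintro ⟨k, z, rfl⟩
    obtain ⟨w, hw⟩ := exists_common_exponent A hA k z (max k 0) (le_max_left _ _)
    refine ⟨(max k 0).toNat, w, ?_⟩
    have : ((max k 0).toNat : ℤ) = max k 0 := Int.toNat_of_nonneg (le_max_right _ _)
    rw [hw, ← this, mulVec_mulVec, Int.toNat_natCast, (hinv _).1, one_mulVec]
  · rintro ⟨k, z, h⟩
    refine ⟨k, z, ?_⟩
    rw [← h, mulVec_mulVec, (hinv k).2, one_mulVec]

theorem intVec_mem_groupG (A : Matrix (Fin n) (Fin n) ℤ) (hA : A.det ≠ 0) (z : Fin n → ℤ) :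
    intVec ℚ z ∈ groupG A hA := (mem_groupG_iff A hA _).mpr ⟨0, z, by simp⟩

theorem mulVec_mem_groupG_iff (A : Matrix (Fin n) (Fin n) ℤ) (hA : A.det ≠ 0) (x : Fin n → ℚ) :
    matOver ℚ A *ᵥ x ∈ groupG A hA ↔ x ∈ groupG A hA := by
  rw [mem_groupG_iff, mem_groupG_iff]
  constructor
  · rintro ⟨k, z, h⟩
    exact ⟨k + 1, z, by rw [← h, mulVec_mulVec, pow_succ]⟩
  · rintro ⟨k, z, h⟩
    exact ⟨k, A *ᵥ z, by rw [intVec_mulVec, ← h, mulVec_mulVec, mulVec_mulVec, ← pow_succ,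
      ← pow_succ']⟩

theorem Rat.exists_int_of_forall_padic_norm_le_one (q : ℚ)
    (h : ∀ (p : ℕ) [Fact p.Prime], ‖(q : ℚ_[p])‖ ≤ 1) : ∃ z : ℤ, q = z := by
  refine ⟨q.num, ?_⟩
  have : q.den = 1 := by
    by_contra hd
    obtain ⟨p, hp, hpd⟩ := Nat.exists_prime_and_dvd hd
    have : Fact p.Prime := ⟨hp⟩
    have h1 : (q : ℚ_[p]) * ((q.den : ℤ) : ℚ_[p]) = ((q.num : ℤ) : ℚ_[p]) := by
      have := Rat.mul_den_eq_num q
      exact_mod_cast congrArg (fun x : ℚ => (x : ℚ_[p])) this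
    have h2 : ‖((q.num : ℤ) : ℚ_[p])‖ < 1 := by
      rw [← h1, norm_mul]
      have := (Padic.norm_intCast_lt_one_iff (p := p) (k := (q.den : ℤ))).mpr (by exact_mod_cast hpd)
      exact (mul_le_of_le_one_left (norm_nonneg _) (h p)).trans_lt this
    have h3 := (Padic.norm_intCast_lt_one_iff (p := p) (k := q.num)).mp h2
    have h4 := Nat.dvd_gcd (Int.natCast_dvd.mp h3) hpd
    rw [q.reduced.gcd_eq_one] at h4
    exact hp.one_lt.ne' (Nat.dvd_one.mp h4)
  rw [← Rat.num_div_den q, this]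
  simp

theorem norm_castVec_intVec_le (p : ℕ) [Fact p.Prime] (z : Fin n → ℤ) :
    ‖castVec ℚ_[p] (intVec ℚ z)‖ ≤ 1 := by
  rw [pi_norm_le_iff_of_nonneg zero_le_one]
  intro i
  simpa [castVec, intVec] using Padic.norm_int_le_one (p := p) (z i)

theorem norm_matOver_le (p : ℕ) [Fact p.Prime] (A : Matrix (Fin n) (Fin n) ℤ) (i j : Fin n) :
    ‖matOver ℚ_[p] A i j‖ ≤ 1 := by
  simpa [matOver] using Padic.norm_int_le_one (p := p) (A i j)

theorem norm_pow_mulVec_le {p : ℕ} [Fact p.Prime] {M : Matrix (Fin n) (Fin n) ℚ_[p]}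
    (hM : ∀ i j, ‖M i j‖ ≤ 1) (x : Fin n → ℚ_[p]) (k : ℕ) : ‖M ^ k *ᵥ x‖ ≤ ‖x‖ := by
  induction k with
  | zero => simp
  | succ k ih =>
    rw [pow_succ', ← mulVec_mulVec]
    exact (norm_mulVec_le hM _).trans ih

/-- Membership in `G_A` is a local condition. -/
theorem mem_groupG_iff_padic (A : Matrix (Fin n) (Fin n) ℤ) (hA : A.det ≠ 0) (x : Fin n → ℚ) :
    x ∈ groupG A hA ↔ ∀ (p : ℕ) [Fact p.Prime],
      ∃ k : ℕ, ‖matOver ℚ_[p] A ^ k *ᵥ castVec ℚ_[p] x‖ ≤ 1 := by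
  rw [mem_groupG_iff]
  constructor
  · rintro ⟨k, z, h⟩ p _
    refine ⟨k, ?_⟩
    rw [← castMat_matOver, ← map_pow, ← castVec_mulVec, h]
    exact norm_castVec_intVec_le p z
  · intro h
    have h' : ∀ p : ℕ, ∃ k : ℕ, ∀ [Fact p.Prime],
        ‖matOver ℚ_[p] A ^ k *ᵥ castVec ℚ_[p] x‖ ≤ 1 := by
      intro p
      by_cases hp : Fact p.Prime
      · obtain ⟨k, hk⟩ := h p
        exact ⟨k, hk⟩
      · exact ⟨0, fun {hp'} => absurd hp' hp⟩
    choose k hk using h'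
    -- Only the finitely many primes dividing `d` need a positive exponent, so one exponent `m`
    -- serves all primes.
    set d := ∏ i, (x i).den with hd
    have hd0 : d ≠ 0 := Finset.prod_ne_zero_iff.mpr fun i _ => (x i).den_nz
    set m := d.primeFactors.sup k with hm
    have hint : ∀ (p : ℕ) [Fact p.Prime], ‖matOver ℚ_[p] A ^ m *ᵥ castVec ℚ_[p] x‖ ≤ 1 := by
      intro p hp
      by_cases hpd : p ∣ d
      · have hkm : k p ≤ m := Finset.le_sup (Nat.mem_primeFactors.mpr ⟨hp.out, hpd, hd0⟩)
        rw [← Nat.sub_add_cancel hkm, pow_add, ← mulVec_mulVec]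
        exact (norm_pow_mulVec_le (norm_matOver_le p A) _ _).trans (hk p)
      · refine (norm_pow_mulVec_le (norm_matOver_le p A) _ _).trans ?_
        rw [pi_norm_le_iff_of_nonneg zero_le_one]
        intro i
        exact Padic.norm_rat_le_one fun hi =>
          hpd (hi.trans (Finset.dvd_prod_of_mem _ (Finset.mem_univ i)))
    have : ∀ i, ∃ z : ℤ, (matOver ℚ A ^ m *ᵥ x) i = z := by
      intro i
      apply Rat.exists_int_of_forall_padic_norm_le_one
      intro p hp
      have := (norm_le_pi_norm _ i).trans (hint p)
      rwa [← castMat_matOver, ← map_pow, ← castVec_mulVec] at this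
    choose z hz using this
    exact ⟨m, z, funext hz⟩

/-- The powers of a rational matrix that is integral over `ℤ` have a common denominator. -/
theorem exists_common_denominator_pow (C : Matrix (Fin n) (Fin n) ℚ) (g : ℤ[X]) (hg : g.Monic)
    (hC : aeval C g = 0) :
    ∃ N : ℕ, N ≠ 0 ∧ ∀ k : ℕ, ∃ Z : Matrix (Fin n) (Fin n) ℤ,
      (N : ℚ) • C ^ k = matOver ℚ Z := by
  set N := ∏ l ∈ Finset.range (g.natDegree + 1), ∏ i, ∏ j, ((C ^ l) i j).den with hN
  have hN0 : N ≠ 0 := Finset.prod_ne_zero_iff.mpr fun l _ => Finset.prod_ne_zero_iff.mpr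
    fun i _ => Finset.prod_ne_zero_iff.mpr fun j _ => Rat.den_nz _
  let R : AddSubgroup (Matrix (Fin n) (Fin n) ℚ) :=
    { carrier := {M | ∃ Z : Matrix (Fin n) (Fin n) ℤ, (N : ℚ) • M = matOver ℚ Z}
      zero_mem' := ⟨0, by ext; simp [matOver]⟩
      add_mem' := by
        rintro a b ⟨Z, hZ⟩ ⟨W, hW⟩
        refine ⟨Z + W, ?_⟩
        rw [smul_add, hZ, hW]
        ext; simp [matOver]
      neg_mem' := by
        rintro a ⟨Z, hZ⟩
        refine ⟨-Z, ?_⟩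
        rw [smul_neg, hZ]
        ext; simp [matOver] }
  have hsmall : ∀ l ∈ Finset.range (g.natDegree + 1), C ^ l ∈ R := by
    intro l hl
    have : ∀ i j, ∃ z : ℤ, (N : ℚ) * (C ^ l) i j = z := by
      intro i j
      have h1 : ((C ^ l) i j).den ∣ N :=
        (((Finset.dvd_prod_of_mem _ (Finset.mem_univ j)).trans
          (Finset.dvd_prod_of_mem (fun i => ∏ j, ((C ^ l) i j).den) (Finset.mem_univ i))).trans
          (Finset.dvd_prod_of_mem (fun l => ∏ i, ∏ j, ((C ^ l) i j).den) hl))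
      obtain ⟨e, he⟩ := h1
      refine ⟨e * ((C ^ l) i j).num, ?_⟩
      rw [he]
      push_cast
      rw [← Rat.mul_den_eq_num ((C ^ l) i j)]
      ring
    choose Z hZ using this
    exact ⟨Matrix.of Z, by ext i j; simp [matOver, hZ]⟩
  refine ⟨N, hN0, fun k => ?_⟩
  change C ^ k ∈ R
  -- Reduction modulo the monic `g` writes every power of `C` as an integer combination of the
  -- powers whose denominators `N` clears.
  have h1 : C ^ k = aeval C (X ^ k %ₘ g) := by
    have := congrArg (aeval C) (modByMonic_add_div (X ^ k : ℤ[X]) g)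
    rw [map_add, map_mul, hC, zero_mul, add_zero] at this
    rw [this]; simp
  rw [h1, aeval_eq_sum_range]
  refine AddSubgroup.sum_mem _ fun l hl => AddSubgroup.zsmul_mem _ (hsmall l ?_) _
  have := natDegree_modByMonic_le (X ^ k : ℤ[X]) hg
  rw [Finset.mem_range] at hl ⊢
  omega

theorem powerBounded_castMat (p : ℕ) [Fact p.Prime] (C : Matrix (Fin n) (Fin n) ℚ) (N : ℕ)
    (hN : N ≠ 0) (h : ∀ k : ℕ, ∃ Z : Matrix (Fin n) (Fin n) ℤ, (N : ℚ) • C ^ k = matOver ℚ Z) :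
    PowerBounded (castMat ℚ_[p] C) := by
  refine ⟨‖(N : ℚ_[p])‖⁻¹, by positivity, fun k x => ?_⟩
  have hN' : (N : ℚ_[p]) ≠ 0 := by exact_mod_cast hN
  obtain ⟨Z, hZ⟩ := h k
  have h1 : (N : ℚ_[p]) • castMat ℚ_[p] C ^ k = matOver ℚ_[p] Z := by
    rw [← castMat_matOver, ← hZ, ← map_pow]
    ext i j
    rw [Matrix.smul_apply, castMat_apply, castMat_apply, Matrix.smul_apply, smul_eq_mul,
      smul_eq_mul, Rat.cast_mul, Rat.cast_natCast]
  have h2 : castMat ℚ_[p] C ^ k *ᵥ x = (N : ℚ_[p])⁻¹ • (matOver ℚ_[p] Z *ᵥ x) := by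
    rw [← h1, smul_mulVec, smul_smul, inv_mul_cancel₀ hN', one_smul]
  rw [h2, norm_smul, norm_inv]
  gcongr
  exact norm_mulVec_le (norm_matOver_le p Z) x

/-- Determinants of `N M ^ (r k) = M' ^ k (N D ^ k)` show that, if `p` did not divide `det B`, every
power of `p` would divide the fixed number `N ^ n`. -/
theorem dvd_det_of_pow_eq {p : ℕ} (hp : p.Prime) (A B : Matrix (Fin n) (Fin n) ℤ)
    (M M' D : Matrix (Fin n) (Fin n) ℚ) (hM : M.det = B.det) (hM' : M'.det = A.det)
    (hc : Commute M' D) {r : ℕ}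
    (hr : M ^ r = M' * D) (N : ℕ) (hN : N ≠ 0)
    (h : ∀ k : ℕ, ∃ Z : Matrix (Fin n) (Fin n) ℤ, (N : ℚ) • D ^ k = matOver ℚ Z)
    (hpA : (p : ℤ) ∣ A.det) : (p : ℤ) ∣ B.det := by
  by_contra hB
  have hcop : ∀ k : ℕ, ((p : ℤ) ^ k) ∣ (N : ℤ) ^ n := by
    intro k
    obtain ⟨Z, hZ⟩ := h k
    have h1 : (N : ℤ) ^ n * (B.det ^ r) ^ k = A.det ^ k * Z.det := by
      have : (N : ℚ) • (M ^ r) ^ k = M' ^ k * matOver ℚ Z := by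
        rw [hr, hc.mul_pow, ← hZ, mul_smul_comm]
      have := congrArg Matrix.det this
      rw [det_smul, det_mul, det_pow, det_pow, det_pow, hM, hM', det_matOver,
        Fintype.card_fin] at this
      exact_mod_cast this
    have h2 : IsCoprime ((p : ℤ) ^ k) ((B.det ^ r) ^ k) :=
      (((Nat.prime_iff_prime_int.mp hp).coprime_iff_not_dvd.mpr hB).pow_right.pow_right).pow_left
    exact h2.dvd_of_dvd_mul_right (h1 ▸ (pow_dvd_pow_of_dvd hpA k).mul_right _)
  -- The exponent `N ^ n` is large enough, since `p ^ m > m`.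
  have := hcop (N ^ n)
  have h3 : p ^ (N ^ n) ≤ N ^ n := Nat.le_of_dvd (by positivity) (by exact_mod_cast this)
  exact absurd h3 (not_le.mpr (Nat.lt_pow_self hp.one_lt))

theorem mem_ringR_iff (A : Matrix (Fin n) (Fin n) ℤ) (hA : A.det ≠ 0) (q : ℚ) :
    q ∈ ringR A ↔ ∃ (k : ℕ) (z : ℤ), (A.det : ℚ) ^ k * q = z := by
  rw [ringR]
  generalize A.det = d at hA
  have hA' : (d : ℚ) ≠ 0 := by exact_mod_cast hA
  constructor
  · intro h
    induction h using Algebra.adjoin_induction with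
    | mem x hx =>
      rw [Set.mem_singleton_iff] at hx
      exact ⟨1, 1, by simp [hx, hA']⟩
    | algebraMap r => exact ⟨0, r, by simp⟩
    | add x y _ _ hx hy =>
      obtain ⟨k, z, hz⟩ := hx
      obtain ⟨l, w, hw⟩ := hy
      refine ⟨k + l, d ^ l * z + d ^ k * w, ?_⟩
      push_cast
      rw [← hz, ← hw]; ring
    | mul x y _ _ hx hy =>
      obtain ⟨k, z, hz⟩ := hx
      obtain ⟨l, w, hw⟩ := hy
      refine ⟨k + l, z * w, ?_⟩
      push_cast
      rw [← hz, ← hw]; ring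
  · rintro ⟨k, z, h⟩
    have : q = algebraMap ℤ ℚ z * ((d : ℚ)⁻¹) ^ k := by
      rw [eq_intCast, ← h, mul_right_comm, ← mul_pow, mul_inv_cancel₀ hA', one_pow, one_mul]
    rw [this]
    exact mul_mem (Subalgebra.algebraMap_mem _ z)
      (pow_mem (Algebra.subset_adjoin (Set.mem_singleton _)) k)

theorem norm_le_one_of_mem_ringR (p : ℕ) [Fact p.Prime] (A : Matrix (Fin n) (Fin n) ℤ)
    (hA : A.det ≠ 0) (hp : ¬ (p : ℤ) ∣ A.det) {q : ℚ} (hq : q ∈ ringR A) :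
    ‖(q : ℚ_[p])‖ ≤ 1 := by
  obtain ⟨k, z, h⟩ := (mem_ringR_iff A hA q).mp hq
  generalize A.det = d at hp h
  have h1 : (d : ℚ_[p]) ^ k * (q : ℚ_[p]) = (z : ℚ_[p]) := by
    exact_mod_cast congrArg (fun x : ℚ => (x : ℚ_[p])) h
  have h2 : ‖(d : ℚ_[p])‖ = 1 :=
    le_antisymm (Padic.norm_int_le_one _)
      (not_lt.mp fun h => hp (Padic.norm_intCast_lt_one_iff.mp h))
  have h3 := congrArg norm h1
  rw [norm_mul, norm_pow, h2, one_pow, one_mul] at h3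
  rw [h3]
  exact Padic.norm_int_le_one z

theorem ringR_le_of_dvd (A B : Matrix (Fin n) (Fin n) ℤ) (hA : A.det ≠ 0) (hB : B.det ≠ 0)
    (k : ℕ) (h : B.det ∣ A.det ^ k) : ringR B ≤ ringR A := by
  obtain ⟨d, hd⟩ := h
  rw [ringR, Algebra.adjoin_le_iff, Set.singleton_subset_iff]
  refine (mem_ringR_iff A hA _).mpr ⟨k, d, ?_⟩
  have hB' : (B.det : ℚ) ≠ 0 := by exact_mod_cast hB
  have : (A.det : ℚ) ^ k = B.det * d := by exact_mod_cast hd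
  rw [this]
  field_simp

variable {K : Type*} [Field K] [NumberField K]

theorem mem_idealR_iff (A : Matrix (Fin n) (Fin n) ℤ) (u : Fin n → K) (x : K) :
    x ∈ idealR A u ↔ ∃ r : Fin n → ℚ, (∀ i, r i ∈ ringR A) ∧ x = ∑ i, (r i : K) * u i := by
  have h1 : idealR A u = Submodule.span (ringR A) (Set.range u) := by
    refine le_antisymm (Submodule.span_le.mpr fun y hy => ?_)
      (Submodule.span_mono Submodule.subset_span)
    have : idealZ u ≤ (Submodule.span (ringR A) (Set.range u)).restrictScalars ℤ :=
      Submodule.span_le.mpr Submodule.subset_span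
    exact this hy
  have hs : ∀ (c : ringR A) (y : K), c • y = ((c : ℚ) : K) * y := fun c y => by
    rw [Subalgebra.smul_def, Algebra.smul_def]; rfl
  rw [h1, Submodule.mem_span_range_iff_exists_fun]
  constructor
  · rintro ⟨c, rfl⟩
    exact ⟨fun i => c i, fun i => (c i).2, by simp [hs]⟩
  · rintro ⟨r, hr, rfl⟩
    exact ⟨fun i => ⟨r i, hr i⟩, by simp [hs]⟩

end

/-! ### Isomorphisms as rational matrices -/

section

open Matrix Polynomial

variable {n : ℕ}

theorem intVec_single (j : Fin n) : intVec ℚ (Pi.single j 1) = Pi.single j (1 : ℚ) := by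
  ext i
  by_cases hij : i = j
  · subst hij; simp [intVec]
  · simp [intVec, hij]

theorem intVec_eq_sum (z : Fin n → ℤ) :
    intVec ℚ z = ∑ j, z j • intVec ℚ (Pi.single j 1) := by
  ext i
  simp [intVec, Finset.sum_apply, Pi.single_apply]

theorem exists_nsmul_eq_intVec (x : Fin n → ℚ) :
    ∃ (N : ℕ) (z : Fin n → ℤ), N ≠ 0 ∧ N • x = intVec ℚ z := by
  have hd0 : ∏ i, (x i).den ≠ 0 := Finset.prod_ne_zero_iff.mpr fun i _ => (x i).den_nz
  have : ∀ i, ∃ z : ℤ, ((∏ i, (x i).den : ℕ) : ℚ) * x i = z := fun i => by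
    obtain ⟨e, he⟩ := Finset.dvd_prod_of_mem (fun i => (x i).den) (Finset.mem_univ i)
    refine ⟨e * (x i).num, ?_⟩
    rw [he]
    push_cast
    rw [← Rat.mul_den_eq_num (x i)]
    ring
  choose z hz using this
  exact ⟨_, z, hd0, by ext i; simp [intVec, ← hz]⟩

/-- An additive map on `G_A` is given by a rational matrix. -/
theorem exists_matrix_of_addMonoidHom (A : Matrix (Fin n) (Fin n) ℤ) (hA : A.det ≠ 0)
    (f : groupG A hA →+ (Fin n → ℚ)) :
    ∃ T : Matrix (Fin n) (Fin n) ℚ, ∀ x : groupG A hA, f x = T *ᵥ (x : Fin n → ℚ) := by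
  let e : Fin n → groupG A hA := fun j => ⟨_, intVec_mem_groupG A hA (Pi.single j 1)⟩
  refine ⟨Matrix.of fun i j => f (e j) i, fun x => ?_⟩
  -- A multiple of `x` is an integer combination of the standard vectors, and the target is
  -- torsion-free.
  obtain ⟨N, z, hN, hz⟩ := exists_nsmul_eq_intVec (x : Fin n → ℚ)
  have h1 : N • x = ∑ j, z j • e j := by
    apply Subtype.ext
    rw [AddSubgroup.coe_nsmul, hz, intVec_eq_sum]
    simp [e]
  have h2 := congrArg f h1
  rw [map_nsmul, map_sum] at h2
  have hN' : (N : ℚ) ≠ 0 := by exact_mod_cast hN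
  ext i
  have h3 := congrFun h2 i
  have h4 : ∀ j, (z j : ℚ) = N * (x : Fin n → ℚ) j := fun j => by
    simpa [intVec] using (congrFun hz j).symm
  simp only [Pi.smul_apply, nsmul_eq_mul, Finset.sum_apply, map_zsmul] at h3
  apply mul_left_cancel₀ hN'
  rw [h3]
  simp only [mulVec, dotProduct, Matrix.of_apply, Finset.mul_sum]
  exact Finset.sum_congr rfl fun j _ => by rw [zsmul_eq_mul, h4]; ring

theorem eq_one_of_forall_mem_groupG (A : Matrix (Fin n) (Fin n) ℤ) (hA : A.det ≠ 0)
    (M : Matrix (Fin n) (Fin n) ℚ) (h : ∀ x ∈ groupG A hA, M *ᵥ x = x) : M = 1 := by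
  ext i j
  have h1 := congrFun (h _ (intVec_mem_groupG A hA (Pi.single j 1))) i
  rw [intVec_single, mulVec_single_one] at h1
  simpa [Matrix.one_apply, Pi.single_apply] using h1

theorem exists_matrix_of_addEquiv (A B : Matrix (Fin n) (Fin n) ℤ) (hA : A.det ≠ 0)
    (hB : B.det ≠ 0) (e : groupG A hA ≃+ groupG B hB) :
    ∃ T T' : Matrix (Fin n) (Fin n) ℚ, T' * T = 1 ∧ T * T' = 1 ∧
      (∀ x ∈ groupG A hA, T *ᵥ x ∈ groupG B hB) ∧
      ∀ x ∈ groupG B hB, T' *ᵥ x ∈ groupG A hA := by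
  obtain ⟨T, hT⟩ := exists_matrix_of_addMonoidHom A hA
    ((groupG B hB).subtype.comp e.toAddMonoidHom)
  obtain ⟨T', hT'⟩ := exists_matrix_of_addMonoidHom B hB
    ((groupG A hA).subtype.comp e.symm.toAddMonoidHom)
  have hT1 : ∀ x : groupG A hA, T *ᵥ (x : Fin n → ℚ) = e x := fun x => (hT x).symm
  have hT1' : ∀ x : groupG B hB, T' *ᵥ (x : Fin n → ℚ) = e.symm x := fun x => (hT' x).symm
  have hone : T' * T = 1 := eq_one_of_forall_mem_groupG A hA _ fun x hx => by
    rw [← mulVec_mulVec, hT1 ⟨x, hx⟩, hT1', e.symm_apply_apply]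
  exact ⟨T, T', hone, mul_eq_one_comm.mp hone, fun x hx => hT1 ⟨x, hx⟩ ▸ (e ⟨x, hx⟩).2,
    fun x hx => hT1' ⟨x, hx⟩ ▸ (e.symm ⟨x, hx⟩).2⟩

theorem norm_dotProduct_le {p : ℕ} [Fact p.Prime] {φ : Fin n → ℚ_[p]} (hφ : ∀ i, ‖φ i‖ ≤ 1)
    (x : Fin n → ℚ_[p]) : ‖φ ⬝ᵥ x‖ ≤ ‖x‖ := by
  refine IsUltrametricDist.norm_sum_le_of_forall_le_of_nonneg (norm_nonneg _) fun j _ => ?_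
  rw [norm_mul]
  exact (mul_le_of_le_one_left (norm_nonneg _) (hφ j)).trans (norm_le_pi_norm x j)

theorem norm_vecMul_le {p : ℕ} [Fact p.Prime] {M : Matrix (Fin n) (Fin n) ℚ_[p]}
    (hM : ∀ i j, ‖M i j‖ ≤ 1) (x : Fin n → ℚ_[p]) : ‖x ᵥ* M‖ ≤ ‖x‖ := by
  rw [← mulVec_transpose]
  exact norm_mulVec_le (fun i j => hM j i) x

/-- A rational matrix that preserves `G_A` commutes with `A`, if zero is a root of multiplicity
`n - 1` of the characteristic polynomial of `A` modulo some `p`. -/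
theorem commute_of_preserves_groupG (A : Matrix (Fin n) (Fin n) ℤ) (hA : A.det ≠ 0)
    (hirr : Irreducible A.charpoly) {p : ℕ} (hp : p ∈ primesP' A) (ht : multZero A p = n - 1)
    (M : Matrix (Fin n) (Fin n) ℚ) (hM : ∀ x ∈ groupG A hA, M *ᵥ x ∈ groupG A hA) :
    Commute (matOver ℚ A) M := by
  have : Fact p.Prime := ⟨hp.1.1⟩
  obtain ⟨P, c, hc, hPint, hAP, hPA, hk, hP0⟩ := exists_rational_projection A
    (pos_of_irreducible_charpoly A hirr) hp.1.2 fun _ => ht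
  obtain ⟨i, hi⟩ : ∃ i, P i ≠ 0 := by
    by_contra! h
    exact hP0 hp (funext h)
  -- A nonzero row of `P` is a left eigenvector of `A` for `c`, and it is bounded on `G_A` because
  -- `c` has norm one.
  set φ := P i with hφ
  set A' := matOver ℚ_[p] A with hA'
  have hφA : φ ᵥ* A' = c • φ := by
    have := congrFun hPA i
    rwa [mul_apply_eq_vecMul] at this
  have hφAk : ∀ k : ℕ, φ ᵥ* A' ^ k = c ^ k • φ := by
    intro k
    induction k with
    | zero => simp
    | succ k ih => rw [pow_succ, ← vecMul_vecMul, ih, smul_vecMul, hφA, smul_smul, pow_succ]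
  have hφG : ∀ x ∈ groupG A hA, ‖φ ⬝ᵥ castVec ℚ_[p] x‖ ≤ 1 := by
    intro x hx
    obtain ⟨k, hk⟩ := (mem_groupG_iff_padic A hA x).mp hx p
    have h1 : ‖φ ⬝ᵥ (A' ^ k *ᵥ castVec ℚ_[p] x)‖ = ‖φ ⬝ᵥ castVec ℚ_[p] x‖ := by
      rw [dotProduct_mulVec, hφAk, smul_dotProduct, norm_smul, norm_pow, hc, one_pow, one_mul]
    rw [← h1]
    exact (norm_dotProduct_le (hPint i) _).trans hk
  set χ := φ ᵥ* castMat ℚ_[p] M with hχ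
  have hχG : ∀ x ∈ groupG A hA, ‖χ ⬝ᵥ castVec ℚ_[p] x‖ ≤ 1 := by
    intro x hx
    rw [hχ, ← dotProduct_mulVec, ← castVec_mulVec]
    exact hφG _ (hM x hx)
  -- `ψ` equals `φ (M A - A M)`. It is bounded on `G_A`, in particular on all `A⁻ᵏ e_j`, and it
  -- annihilates `P`.
  set ψ := χ ᵥ* A' - c • χ with hψ
  have hψG : ∀ x ∈ groupG A hA, ‖ψ ⬝ᵥ castVec ℚ_[p] x‖ ≤ 1 := by
    intro x hx
    rw [hψ, sub_dotProduct, smul_dotProduct, ← dotProduct_mulVec, hA', ← castMat_matOver ℚ_[p],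
      ← castVec_mulVec, sub_eq_add_neg]
    refine (Padic.nonarchimedean _ _).trans (max_le ?_ ?_)
    · exact hχG _ ((mulVec_mem_groupG_iff A hA x).mpr hx)
    · rw [norm_neg, norm_smul, hc, one_mul]
      exact hχG x hx
  have hu := isUnit_det_matOver A hA
  have hψb : ∀ k : ℕ, ‖ψ ᵥ* castMat ℚ_[p] ((matOver ℚ A)⁻¹ ^ k)‖ ≤ 1 := by
    intro k
    rw [pi_norm_le_iff_of_nonneg zero_le_one]
    intro j
    have hmem : (matOver ℚ A)⁻¹ ^ k *ᵥ intVec ℚ (Pi.single j 1) ∈ groupG A hA := by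
      refine (mem_groupG_iff A hA _).mpr ⟨k, Pi.single j 1, ?_⟩
      rw [mulVec_mulVec, Matrix.inv_pow', mul_nonsing_inv _ (by rw [det_pow]; exact hu.pow k),
        one_mulVec]
    have h1 := hψG _ hmem
    rw [castVec_mulVec, dotProduct_mulVec] at h1
    have h2 : castVec ℚ_[p] (intVec ℚ (Pi.single j 1)) = Pi.single j 1 := by
      ext l
      by_cases hlj : l = j
      · subst hlj; simp [castVec, intVec]
      · simp [castVec, intVec, hlj]
    rwa [h2, dotProduct_single_one] at h1
  have hψP : ψ ᵥ* P = 0 := by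
    rw [hψ, sub_vecMul, vecMul_vecMul, hAP, vecMul_smul, smul_vecMul, sub_self]
  -- Write `ψ = (ψ A⁻ᵏ) (A ^ k (1 - P))`: the first factor is bounded for all `k` and the second is
  -- divisible by `p ^ j` for a suitable `k`.
  have hψsmall : ∀ j : ℕ, ‖ψ‖ ≤ ‖(p : ℚ_[p])‖ ^ j := by
    intro j
    obtain ⟨k, Q, hQ, hkQ⟩ := hk j
    have h1 : ψ = (p : ℚ_[p]) ^ j • ((ψ ᵥ* castMat ℚ_[p] ((matOver ℚ A)⁻¹ ^ k)) ᵥ* Q) := by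
      rw [← vecMul_smul, ← hkQ, ← vecMul_vecMul, vecMul_vecMul ψ, hA',
        ← castMat_matOver ℚ_[p], ← map_pow,
        ← map_mul, Matrix.inv_pow', nonsing_inv_mul _ (by rw [det_pow]; exact hu.pow k), map_one,
        vecMul_one, vecMul_sub, hψP, vecMul_one, sub_zero]
    rw [h1, norm_smul, norm_pow]
    exact mul_le_of_le_one_right (by positivity) ((norm_vecMul_le hQ _).trans (hψb k))
  have hψ0 : ψ = 0 := by
    rw [← norm_le_zero_iff]
    exact ge_of_tendsto' (tendsto_pow_atTop_nhds_zero_of_lt_one (norm_nonneg _)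
      (Padic.norm_p_lt_one (p := p))) hψsmall
  -- `φ` is an eigenvector of the transpose of `A`, and a rational matrix that kills it is zero.
  have hfin : (M * matOver ℚ A - matOver ℚ A * M)ᵀ = 0 := by
    refine matrix_eq_zero_of_mulVec_eigenvector Aᵀ (by rwa [charpoly_transpose]) hi (c := c) ?_ _ ?_
    · rw [matOver_transpose, mulVec_transpose, hφA]
    · change castMat ℚ_[p] (M * matOver ℚ A - matOver ℚ A * M)ᵀ *ᵥ φ = 0
      have : castMat ℚ_[p] (M * matOver ℚ A - matOver ℚ A * M)ᵀ =
          (castMat ℚ_[p] (M * matOver ℚ A - matOver ℚ A * M))ᵀ := rfl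
      rw [this, mulVec_transpose, map_sub, map_mul, map_mul, castMat_matOver, vecMul_sub,
        ← vecMul_vecMul, ← vecMul_vecMul, hφA, smul_vecMul]
      exact hψ0
  have := congrArg Matrix.transpose hfin
  rw [transpose_transpose, transpose_zero, sub_eq_zero] at this
  exact this.symm

theorem exists_pow_mul_eq_matOver (A : Matrix (Fin n) (Fin n) ℤ) (hA : A.det ≠ 0)
    (M : Matrix (Fin n) (Fin n) ℚ) (hM : ∀ z, M *ᵥ intVec ℚ z ∈ groupG A hA) :
    ∃ (k : ℕ) (Z : Matrix (Fin n) (Fin n) ℤ), matOver ℚ A ^ k * M = matOver ℚ Z := by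
  have := fun j : Fin n => (mem_groupG_iff A hA _).mp (hM (Pi.single j 1))
  choose k z hz using this
  set m := Finset.univ.sup k
  refine ⟨m, Matrix.of fun i j => (A ^ (m - k j) *ᵥ z j) i, ?_⟩
  ext i j
  have hkm : k j ≤ m := Finset.le_sup (Finset.mem_univ j)
  have h1 : intVec ℚ (A ^ (m - k j) *ᵥ z j) =
      (matOver ℚ A ^ m * M) *ᵥ intVec ℚ (Pi.single j 1) := by
    rw [intVec_mulVec, ← hz, matOver_pow, mulVec_mulVec, mulVec_mulVec, ← pow_add,
      Nat.sub_add_cancel hkm]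
  rw [intVec_single, mulVec_single_one] at h1
  exact (congrFun h1 i).symm

/-- `T' B⁻¹ T` maps `ℤ^n` into `G_A`, so a power of `A` makes it integral. On eigenvalues and on
determinants this becomes divisibility. -/
theorem exists_pow_eq_matOver_mul (A B : Matrix (Fin n) (Fin n) ℤ) (hA : A.det ≠ 0)
    (hB : B.det ≠ 0) {T T' : Matrix (Fin n) (Fin n) ℚ} (hTT : T' * T = 1)
    (hT : ∀ x ∈ groupG A hA, T *ᵥ x ∈ groupG B hB)
    (hT' : ∀ x ∈ groupG B hB, T' *ᵥ x ∈ groupG A hA) :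
    ∃ (k : ℕ) (Z : Matrix (Fin n) (Fin n) ℤ),
      matOver ℚ A ^ k = matOver ℚ Z * (T' * matOver ℚ B * T) := by
  have hu := isUnit_det_matOver B hB
  obtain ⟨k, Z, h⟩ := exists_pow_mul_eq_matOver A hA (T' * (matOver ℚ B)⁻¹ * T) (by
    intro z
    rw [← mulVec_mulVec, ← mulVec_mulVec]
    apply hT'
    rw [← mulVec_mem_groupG_iff, mulVec_mulVec _ (matOver ℚ B), mul_nonsing_inv _ hu, one_mulVec]
    exact hT _ (intVec_mem_groupG A hA z))
  refine ⟨k, Z, ?_⟩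
  have h1 : (T' * (matOver ℚ B)⁻¹ * T) * (T' * matOver ℚ B * T) = 1 := by
    have h2 : T * T' = 1 := mul_eq_one_comm.mp hTT
    calc _ = T' * (matOver ℚ B)⁻¹ * (T * T') * matOver ℚ B * T := by simp only [mul_assoc]
      _ = T' * ((matOver ℚ B)⁻¹ * matOver ℚ B) * T := by rw [h2, mul_one]; simp only [mul_assoc]
      _ = 1 := by rw [nonsing_inv_mul _ hu, mul_one, hTT]
  rw [← h, mul_assoc, h1, mul_one]

end

/-! ### Eigenvalues and the direct implication -/

section

open Matrix Polynomial

variable {n : ℕ}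

theorem aeval_charpoly_eq_zero_of_eigenvector {L : Type*} [Field L] (Z : Matrix (Fin n) (Fin n) ℤ) {c : L}
    {y : Fin n → L} (hy : y ≠ 0) (h : matOver L Z *ᵥ y = c • y) :
    aeval c Z.charpoly = 0 := by
  have h1 : (matOver L Z).charpoly.eval c = 0 := by
    rw [eval_charpoly, ← exists_mulVec_eq_zero_iff]
    refine ⟨y, hy, ?_⟩
    rw [sub_mulVec, h, scalar_apply, ← smul_one_eq_diagonal, smul_mulVec, one_mulVec, sub_self]
  have h2 : (matOver L Z).charpoly = Z.charpoly.map (Int.castRingHom L) := charpoly_map _ _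
  rwa [h2, eval_map] at h1

theorem hasEigenvector_matOver_iff {K : Type*} [Field K] (A : Matrix (Fin n) (Fin n) ℤ) (a : K)
    (u : Fin n → K) : Module.End.HasEigenvector (Matrix.toLin' (matOver K A)) a u ↔
      matOver K A *ᵥ u = a • u ∧ u ≠ 0 := by
  rw [Module.End.hasEigenvector_iff, Module.End.mem_eigenspace_iff, toLin'_apply]

/-- The quotient `a ^ k / b` is an eigenvalue of the integer matrix `Z`, hence an algebraic integer.
-/
theorem exists_integral_quotient {K : Type*} [Field K] (A Z : Matrix (Fin n) (Fin n) ℤ) {x w : Fin n → K} (hx : x ≠ 0)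
    {a b : 𝓞 K} (ha0 : (a : K) ≠ 0) {k : ℕ} (hA : matOver K A *ᵥ x = (a : K) • x)
    (hb : w = (b : K) • x) (h : matOver K A ^ k *ᵥ x = matOver K Z *ᵥ w) : b ∣ a ^ k := by
  have hAk : matOver K A ^ k *ᵥ x = (a : K) ^ k • x := by
    clear h
    induction k with
    | zero => simp
    | succ k ih => rw [pow_succ', ← mulVec_mulVec, ih, mulVec_smul, hA, smul_smul, pow_succ]
  rw [hAk, hb, mulVec_smul] at h
  have hb0 : (b : K) ≠ 0 := by
    intro hb0
    rw [hb0, zero_smul] at h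
    exact (smul_ne_zero (pow_ne_zero k ha0) hx) h
  have h1 : matOver K Z *ᵥ x = ((b : K)⁻¹ * (a : K) ^ k) • x := by
    rw [mul_smul, h, smul_smul, inv_mul_cancel₀ hb0, one_smul]
  have h2 : IsIntegral ℤ ((b : K)⁻¹ * (a : K) ^ k) :=
    ⟨Z.charpoly, charpoly_monic Z, aeval_charpoly_eq_zero_of_eigenvector Z hx h1⟩
  let q : 𝓞 K := ⟨_, h2⟩
  have hq : (q : K) = (b : K)⁻¹ * (a : K) ^ k := rfl
  refine ⟨q, NumberField.RingOfIntegers.ext ?_⟩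
  change algebraMap (𝓞 K) K (a ^ k) = algebraMap (𝓞 K) K (b * q)
  rw [map_mul, map_pow]
  change (a : K) ^ k = (b : K) * (q : K)
  rw [hq, mul_inv_cancel_left₀ hb0]

variable {K : Type*} [Field K] [NumberField K]

theorem samePrimeIdealDivisors_of_dvd_pow {a b : 𝓞 K} {k l : ℕ} (h1 : b ∣ a ^ k)
    (h2 : a ∣ b ^ l) : SamePrimeIdealDivisors a b := by
  have key : ∀ {a b : 𝓞 K} {k : ℕ}, b ∣ a ^ k → ∀ P : Ideal (𝓞 K), P.IsPrime →
      P ∣ Ideal.span {b} → P ∣ Ideal.span {a} := by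
    intro a b k h P hP hb
    rw [Ideal.dvd_span_singleton] at hb ⊢
    exact hP.mem_of_pow_mem k (P.mem_of_dvd h hb)
  exact fun P hP _ => ⟨key h2 P hP, key h1 P hP⟩

/-- Every prime containing `b` contains `a`, so `a` lies in the radical of `(b)`; here `b ≠ 0` keeps
those primes nonzero. -/
theorem exists_dvd_pow_of_samePrimeIdealDivisors {a b : 𝓞 K} (hb : b ≠ 0)
    (h : SamePrimeIdealDivisors a b) : ∃ k : ℕ, b ∣ a ^ k := by
  have h1 : Ideal.span {a} ≤ (Ideal.span {b}).radical := by
    rw [Ideal.radical_eq_sInf, le_sInf_iff]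
    rintro P ⟨hbP, hP⟩
    have hbP' : b ∈ P := hbP (Ideal.mem_span_singleton_self b)
    have hP0 : P ≠ ⊥ := by
      rintro rfl
      exact hb hbP'
    have := (h P hP hP0).mpr (Ideal.dvd_span_singleton.mpr hbP')
    rwa [Ideal.dvd_iff_le] at this
  obtain ⟨k, hk⟩ := Ideal.exists_pow_le_of_le_radical_of_fg h1
    (IsNoetherian.noetherian (Ideal.span {a}))
  rw [Ideal.span_singleton_pow, Ideal.span_singleton_le_span_singleton] at hk
  exact ⟨k, hk⟩

theorem finrank_adjoin_eigenvalue (A : Matrix (Fin n) (Fin n) ℤ) (hirr : Irreducible A.charpoly)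
    {a : K} {u : Fin n → K} (hu : u ≠ 0) (h : matOver K A *ᵥ u = a • u) :
    Module.finrank ℚ ℚ⟮a⟯ = n := by
  have h1 : aeval a (matOver ℚ A).charpoly = 0 := by
    have := aeval_charpoly_eq_zero_of_eigenvector A hu h
    have h2 : (matOver ℚ A).charpoly = A.charpoly.map (Int.castRingHom ℚ) := charpoly_map _ _
    rw [h2]
    exact (aeval_map_algebraMap ℚ a A.charpoly).trans this
  rw [IntermediateField.adjoin.finrank (Algebra.IsIntegral.isIntegral a),
    ← minpoly.eq_of_irreducible_of_monic (irreducible_charpoly_matOver A hirr) h1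
      (charpoly_monic _), charpoly_natDegree_eq_dim, Fintype.card_fin]

/-- An eigenvalue has an eigenvector with coordinates in the field that it generates. -/
theorem exists_eigenvector_adjoin (A : Matrix (Fin n) (Fin n) ℤ) {a : K}
    (ha : (A.charpoly.map (Int.castRingHom K)).IsRoot a) :
    ∃ u : Fin n → K, u ≠ 0 ∧ matOver K A *ᵥ u = a • u ∧ ∀ i, u i ∈ ℚ⟮a⟯ := by
  set g : ℚ⟮a⟯ := IntermediateField.AdjoinSimple.gen ℚ a
  have hg : algebraMap ℚ⟮a⟯ K g = a := IntermediateField.AdjoinSimple.algebraMap_gen ℚ a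
  have h1 : (matOver ℚ⟮a⟯ A).charpoly.eval g = 0 := by
    have h2 : (matOver ℚ⟮a⟯ A).charpoly = A.charpoly.map (Int.castRingHom ℚ⟮a⟯) :=
      charpoly_map _ _
    apply (algebraMap ℚ⟮a⟯ K).injective
    rw [h2, map_zero, ← eval₂_at_apply, hg, eval₂_map]
    have h3 : (algebraMap ℚ⟮a⟯ K).comp (Int.castRingHom ℚ⟮a⟯) = Int.castRingHom K :=
      RingHom.ext_int _ _
    rw [h3, ← eval_map]
    exact ha
  rw [eval_charpoly, ← exists_mulVec_eq_zero_iff] at h1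
  obtain ⟨w, hw, h⟩ := h1
  rw [sub_mulVec, scalar_apply, ← smul_one_eq_diagonal, smul_mulVec, one_mulVec, sub_eq_zero] at h
  refine ⟨fun i => algebraMap ℚ⟮a⟯ K (w i), ?_, ?_, fun i => (w i).2⟩
  · intro h0
    apply hw
    ext i
    simpa using congrFun h0 i
  · ext i
    have := congrArg (algebraMap ℚ⟮a⟯ K) (congrFun h i)
    simp only [Pi.smul_apply, smul_eq_mul, map_mul, hg] at this
    rw [Pi.smul_apply, smul_eq_mul, this]
    simp [mulVec, dotProduct, matOver]

theorem castMat_mulVec_mem {F : IntermediateField ℚ K} (M : Matrix (Fin n) (Fin n) ℚ)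
    {x : Fin n → K} (hx : ∀ i, x i ∈ F) (i : Fin n) : (castMat K M *ᵥ x) i ∈ F := by
  change ∑ j, castMat K M i j * x j ∈ F
  refine sum_mem fun j _ => mul_mem ?_ (hx j)
  rw [castMat_apply]
  exact F.algebraMap_mem (M i j)

/-- If `A ^ k x` is integral, multiplying by the adjugate of `A ^ k` shows that `det A ^ k` clears
the denominators of `x`. -/
theorem apply_mem_ringR_of_mem_groupG (A : Matrix (Fin n) (Fin n) ℤ) (hA : A.det ≠ 0)
    (x : Fin n → ℚ) (hx : x ∈ groupG A hA) (i : Fin n) : x i ∈ ringR A := by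
  obtain ⟨k, z, h⟩ := (mem_groupG_iff A hA x).mp hx
  refine (mem_ringR_iff A hA _).mpr ⟨k, ((A ^ k).adjugate *ᵥ z) i, ?_⟩
  have h1 := congrArg (matOver ℚ (A ^ k).adjugate *ᵥ ·) h
  beta_reduce at h1
  rw [← matOver_pow, mulVec_mulVec, ← matOver_mul, adjugate_mul, ← intVec_mulVec] at h1
  have h2 := congrFun h1 i
  rw [← Int.cast_pow, ← det_pow]
  simp only [intVec] at h2
  rw [← h2]
  have h3 : matOver ℚ ((A ^ k).det • (1 : Matrix (Fin n) (Fin n) ℤ)) =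
      ((A ^ k).det : ℚ) • (1 : Matrix (Fin n) (Fin n) ℚ) := by
    ext i j
    simp only [matOver, Matrix.map_apply, Matrix.smul_apply, smul_eq_mul, map_mul, eq_intCast,
      Matrix.one_apply]
    split_ifs <;> simp
  rw [h3, smul_mulVec, one_mulVec, Pi.smul_apply, smul_eq_mul]

theorem idealR_le (A B : Matrix (Fin n) (Fin n) ℤ) (u v : Fin n → K)
    (T : Matrix (Fin n) (Fin n) ℚ) (hT : ∀ i j, T i j ∈ ringR B) (hR : ringR A ≤ ringR B)
    (hu : u = castMat K T *ᵥ v) : (idealR A u : Set K) ⊆ idealR B v := by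
  intro x hx
  obtain ⟨r, hr, rfl⟩ := (mem_idealR_iff A u x).mp hx
  refine (mem_idealR_iff B v _).mpr ⟨r ᵥ* T, fun j => ?_, ?_⟩
  · change ∑ i, r i * T i j ∈ ringR B
    exact sum_mem fun i _ => mul_mem (hR (hr i)) (hT i j)
  simp only [hu, mulVec, vecMul, dotProduct, castMat_apply, Finset.mul_sum]
  rw [Finset.sum_comm]
  refine Finset.sum_congr rfl fun j _ => ?_
  push_cast
  rw [Finset.sum_mul]
  exact Finset.sum_congr rfl fun i _ => by ring

/-- `T' B T` commutes with `A`, so it shares the eigenvector `x`, with some eigenvalue `b`; then `T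
x` is an eigenvector of `B` for `b`. With these eigenvectors the two modules coincide, so `y = 1`.
-/
theorem exists_eigenvalues_of_addEquiv (A B : Matrix (Fin n) (Fin n) ℤ)
    (hA : A.det ≠ 0) (hB : B.det ≠ 0)
    (hAirr : Irreducible A.charpoly) (hBirr : Irreducible B.charpoly)
    {p : ℕ} (hp : p ∈ primesP' A) (ht : multZero A p = n - 1)
    (hKA : (A.charpoly.map (Int.castRingHom K)).Splits)
    (e : groupG A hA ≃+ groupG B hB) :
    ∃ a b : 𝓞 K,
      Module.End.HasEigenvalue (Matrix.toLin' (matOver K A)) (a : K) ∧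
      Module.End.HasEigenvalue (Matrix.toLin' (matOver K B)) (b : K) ∧
      SamePrimeIdealDivisors a b ∧ SameIdealClass A B (a : K) (b : K) := by
  obtain ⟨T, T', hTT', hT'T, hT, hT'⟩ := exists_matrix_of_addEquiv A B hA hB e
  have hn := pos_of_irreducible_charpoly A hAirr
  have hcomm := commute_of_preserves_groupG A hA hAirr hp ht (T' * matOver ℚ B * T) (by
    intro x hx
    rw [← mulVec_mulVec, ← mulVec_mulVec]
    exact hT' _ ((mulVec_mem_groupG_iff B hB _).mpr (hT x hx)))
  obtain ⟨a, ha⟩ := hKA.exists_eval_eq_zero (by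
    have h2 : (matOver K A).charpoly = A.charpoly.map (Int.castRingHom K) := charpoly_map _ _
    rw [← h2, charpoly_degree_eq_dim, Fintype.card_fin]
    exact_mod_cast hn.ne')
  obtain ⟨x, hx0, hAx, hxa⟩ := exists_eigenvector_adjoin A ha
  set B' := castMat K (T' * matOver ℚ B * T) with hB'
  have hB'comm : Commute (matOver K A) B' := by
    rw [← castMat_matOver]; exact hcomm.map (castMat K)
  let i₀ : Fin n := ⟨0, hn⟩
  have hxi : x i₀ ≠ 0 := fun h => hx0 (eigenvector_eq_zero A hAirr hAx i₀ h)
  set b := (B' *ᵥ x) i₀ / x i₀ with hb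
  have hB'x : B' *ᵥ x = b • x := eigenvector_proportional A hAirr hAx
    (by rw [mulVec_mulVec, hB'comm.eq, ← mulVec_mulVec, hAx, mulVec_smul]) i₀ hxi
  have hba : b ∈ ℚ⟮a⟯ := div_mem (castMat_mulVec_mem _ hxa i₀) (hxa i₀)
  set v := castMat K T *ᵥ x with hv
  have hxv : x = castMat K T' *ᵥ v := by
    rw [hv, mulVec_mulVec, ← map_mul, hTT', map_one, one_mulVec]
  have hv0 : v ≠ 0 := by
    intro h
    rw [h, mulVec_zero] at hxv
    exact hx0 hxv
  have hBv : matOver K B *ᵥ v = b • v := by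
    have h1 : castMat K T * B' = matOver K B * castMat K T := by
      rw [hB', ← map_mul, ← mul_assoc, ← mul_assoc, hT'T, one_mul, map_mul, castMat_matOver]
    rw [hv, mulVec_mulVec, ← h1, ← mulVec_mulVec, hB'x, mulVec_smul]
  -- Both fields have degree `n`; equality puts the coordinates of `v = T x` in `ℚ(b)`.
  have hfield : ℚ⟮b⟯ = ℚ⟮a⟯ := by
    apply IntermediateField.eq_of_le_of_finrank_eq
    · exact IntermediateField.adjoin_simple_le_iff.mpr hba
    · rw [finrank_adjoin_eigenvalue A hAirr hx0 hAx, finrank_adjoin_eigenvalue B hBirr hv0 hBv]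
  have hvb : ∀ i, v i ∈ ℚ⟮b⟯ := fun i => hfield ▸ castMat_mulVec_mem T hxa i
  let a' : 𝓞 K := ⟨a, A.charpoly, charpoly_monic A, aeval_charpoly_eq_zero_of_eigenvector A hx0 hAx⟩
  let b' : 𝓞 K := ⟨b, B.charpoly, charpoly_monic B, aeval_charpoly_eq_zero_of_eigenvector B hv0 hBv⟩
  have ha' : (a' : K) = a := rfl
  have hb' : (b' : K) = b := rfl
  have heA : Module.End.HasEigenvector (Matrix.toLin' (matOver K A)) a x :=
    (hasEigenvector_matOver_iff A a x).mpr ⟨hAx, hx0⟩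
  have heB : Module.End.HasEigenvector (Matrix.toLin' (matOver K B)) b v :=
    (hasEigenvector_matOver_iff B b v).mpr ⟨hBv, hv0⟩
  have hne : ∀ (C : Matrix (Fin n) (Fin n) ℤ) (c : K) (y : Fin n → K), C.det ≠ 0 → y ≠ 0 →
      matOver K C *ᵥ y = c • y → c ≠ 0 := by
    rintro C c y hC hy h rfl
    rw [zero_smul] at h
    have h1 := exists_mulVec_eq_zero_iff.mp ⟨y, hy, h⟩
    have h2 : (matOver K C).det = (C.det : K) := by
      simpa [matOver] using ((Int.castRingHom K).map_det C).symm
    rw [h2] at h1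
    exact hC (by exact_mod_cast h1)
  obtain ⟨k, Z, hZ⟩ := exists_pow_eq_matOver_mul A B hA hB hTT' hT hT'
  obtain ⟨l, W, hW⟩ := exists_pow_eq_matOver_mul B A hB hA hT'T hT' hT
  have hdvd1 : b' ∣ a' ^ k := by
    refine exists_integral_quotient A Z (a := a') (b := b') hx0 (hne A a x hA hx0 hAx) hAx hB'x ?_
    rw [← castMat_matOver, ← map_pow, hZ, map_mul, castMat_matOver, mulVec_mulVec]
  have hdvd2 : a' ∣ b' ^ l := by
    refine exists_integral_quotient B W (a := b') (b := a') hv0 (hne B b v hB hv0 hBv) hBv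
      (w := castMat K (T * matOver ℚ A * T') *ᵥ v) ?_ ?_
    · rw [map_mul, ← mulVec_mulVec, ← hxv, map_mul, ← mulVec_mulVec, castMat_matOver, hAx,
        mulVec_smul, ← hv, ha']
    · rw [← castMat_matOver, ← map_pow, hW, map_mul, castMat_matOver, mulVec_mulVec v]
  have hdet : ∀ {A B Z : Matrix (Fin n) (Fin n) ℤ} {T T' : Matrix (Fin n) (Fin n) ℚ} {k : ℕ},
      T' * T = 1 → matOver ℚ A ^ k = matOver ℚ Z * (T' * matOver ℚ B * T) →
      B.det ∣ A.det ^ k := by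
    intro A B Z T T' k h1 h2
    have h3 := congrArg Matrix.det h1
    have h4 := congrArg Matrix.det h2
    rw [det_mul, det_one] at h3
    simp only [det_mul, det_pow, det_matOver] at h4
    refine ⟨Z.det, ?_⟩
    have : (A.det : ℚ) ^ k = B.det * Z.det := by
      rw [h4]; linear_combination (Z.det : ℚ) * B.det * h3
    exact_mod_cast this
  have hR : ringR A = ringR B := le_antisymm
    (ringR_le_of_dvd B A hB hA l (hdet hT'T hW)) (ringR_le_of_dvd A B hA hB k (hdet hTT' hZ))
  -- The columns of `T` are images of standard vectors, so they lie in `G_B`.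
  have hTR : ∀ i j, T i j ∈ ringR B := fun i j => by
    have := apply_mem_ringR_of_mem_groupG B hB _ (hT _ (intVec_mem_groupG A hA (Pi.single j 1))) i
    rwa [intVec_single, mulVec_single_one] at this
  have hTR' : ∀ i j, T' i j ∈ ringR A := fun i j => by
    have := apply_mem_ringR_of_mem_groupG A hA _ (hT' _ (intVec_mem_groupG B hB (Pi.single j 1))) i
    rwa [intVec_single, mulVec_single_one] at this
  refine ⟨a', b', Module.End.hasEigenvalue_of_hasEigenvector heA,
    Module.End.hasEigenvalue_of_hasEigenvector heB,
    samePrimeIdealDivisors_of_dvd_pow hdvd1 hdvd2, x, v, ⟨heA, hxa⟩, ⟨heB, hvb⟩, 1, one_ne_zero, ?_⟩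
  simp only [one_mul, Set.image_id']
  exact Set.Subset.antisymm (idealR_le A B x v T' (fun i j => hR ▸ hTR' i j) hR.le hxv)
    (idealR_le B A v x T (fun i j => hR ▸ hTR i j) hR.ge hv)

end

/-! ### The converse: local comparison and a global scalar -/

section

open Matrix Polynomial

variable {n : ℕ}

theorem nonempty_addEquiv_of_mem_iff (A B : Matrix (Fin n) (Fin n) ℤ) (hA : A.det ≠ 0)
    (hB : B.det ≠ 0) {T T' : Matrix (Fin n) (Fin n) ℚ} (hTT' : T' * T = 1)
    (h : ∀ x, x ∈ groupG A hA ↔ T *ᵥ x ∈ groupG B hB) :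
    Nonempty (groupG A hA ≃+ groupG B hB) := by
  have hT'T : T * T' = 1 := mul_eq_one_comm.mp hTT'
  refine ⟨{ toFun := fun x => ⟨T *ᵥ x, (h x).mp x.2⟩
            invFun := fun y => ⟨T' *ᵥ y, (h _).mpr ?_⟩
            left_inv := fun x => ?_
            right_inv := fun y => ?_
            map_add' := fun x y => ?_ }⟩
  · rw [mulVec_mulVec, hT'T, one_mulVec]; exact y.2
  · apply Subtype.ext
    simp [hTT']
  · apply Subtype.ext
    simp [hT'T]
  · apply Subtype.ext
    simp [mulVec_add]

theorem exists_rat_padic_norm_eq (s : Finset ℕ) (m : ℕ → ℤ) (hm : ∀ p ∉ s, m p = 0)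
    (hs : ∀ p ∈ s, p.Prime) :
    ∃ z : ℚ, z ≠ 0 ∧ ∀ (p : ℕ) [Fact p.Prime], ‖(z : ℚ_[p])‖ = (p : ℝ) ^ m p := by
  refine ⟨∏ q ∈ s, (q : ℚ) ^ (-m q), Finset.prod_ne_zero_iff.mpr fun q hq =>
    zpow_ne_zero _ (by exact_mod_cast (hs q hq).ne_zero), fun p hp => ?_⟩
  have hone : ∀ q ∈ s, q ≠ p → ‖(((q : ℚ) ^ (-m q) : ℚ) : ℚ_[p])‖ = 1 := by
    intro q hq hqp
    have h1 : ‖(q : ℚ_[p])‖ = 1 := by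
      refine le_antisymm (by simpa using Padic.norm_int_le_one (p := p) q) (not_lt.mp fun h => ?_)
      have := (Padic.norm_intCast_lt_one_iff (p := p) (k := (q : ℤ))).mp (by simpa using h)
      exact hqp ((Nat.prime_dvd_prime_iff_eq hp.out (hs q hq)).mp (by exact_mod_cast this)).symm
    push_cast
    rw [norm_zpow, h1, _root_.one_zpow]
  have hself : ‖(((p : ℚ) ^ (-m p) : ℚ) : ℚ_[p])‖ = (p : ℝ) ^ m p := by
    push_cast
    rw [norm_zpow, Padic.norm_p, _root_.inv_zpow, _root_.zpow_neg, inv_inv]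
  rw [Rat.cast_prod, norm_prod]
  by_cases hps : p ∈ s
  · rw [Finset.prod_eq_single_of_mem p hps hone, hself]
  · rw [hm p hps, zpow_zero]
    exact Finset.prod_eq_one fun q hq => hone q hq fun h => hps (h ▸ hq)

theorem norm_le_norm_mulVec {p : ℕ} [Fact p.Prime] (B : Matrix (Fin n) (Fin n) ℤ)
    (hp : ¬ (p : ℤ) ∣ B.det) (x : Fin n → ℚ_[p]) : ‖x‖ ≤ ‖matOver ℚ_[p] B *ᵥ x‖ := by
  have h2 : ‖(B.det : ℚ_[p])‖ = 1 :=
    le_antisymm (Padic.norm_int_le_one _)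
      (not_lt.mp fun h => hp (Padic.norm_intCast_lt_one_iff.mp h))
  have h3 : (matOver ℚ_[p] B).det = (B.det : ℚ_[p]) := by
    simpa [matOver] using ((Int.castRingHom ℚ_[p]).map_det B).symm
  have h4 : matOver ℚ_[p] B.adjugate = (matOver ℚ_[p] B).adjugate :=
    (Int.castRingHom ℚ_[p]).map_adjugate B
  have h5 : matOver ℚ_[p] B.adjugate *ᵥ (matOver ℚ_[p] B *ᵥ x) = (B.det : ℚ_[p]) • x := by
    rw [mulVec_mulVec, h4, adjugate_mul, h3, smul_mulVec, one_mulVec]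
  calc ‖x‖ = ‖(B.det : ℚ_[p]) • x‖ := by rw [norm_smul, h2, one_mul]
    _ ≤ _ := h5 ▸ norm_mulVec_le (norm_matOver_le p _) _

/-- `B` is invertible over `ℤ_p`, so applying `M` never shrinks `S x`, and the orbit adds nothing to
the lattice, here the standard one. -/
theorem mem_padicOrbit_iff_of_not_dvd {p : ℕ} [Fact p.Prime] (B : Matrix (Fin n) (Fin n) ℤ)
    (hp : ¬ (p : ℤ) ∣ B.det) {S S' M : Matrix (Fin n) (Fin n) ℚ_[p]} (hS : ∀ i j, ‖S i j‖ ≤ 1)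
    (hS' : ∀ i j, ‖S' i j‖ ≤ 1) (hSS' : S' * S = 1) (hSM : S * M = matOver ℚ_[p] B * S)
    (x : Fin n → ℚ_[p]) : x ∈ padicOrbit S M ↔ ‖x‖ ≤ 1 := by
  have hpow : ∀ (k : ℕ) (x : Fin n → ℚ_[p]),
      ‖S *ᵥ x‖ ≤ ‖S *ᵥ (M ^ k *ᵥ x)‖ := by
    intro k
    induction k with
    | zero => intro x; simp
    | succ k ih =>
      intro x
      refine (ih x).trans ?_
      rw [pow_succ', ← mulVec_mulVec, mulVec_mulVec _ S M, hSM, ← mulVec_mulVec]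
      exact norm_le_norm_mulVec B hp _
  constructor
  · rintro ⟨k, hk⟩
    have h1 : x = S' *ᵥ (S *ᵥ x) := by rw [mulVec_mulVec, hSS', one_mulVec]
    rw [h1]
    exact (norm_mulVec_le hS' _).trans ((hpow k x).trans hk)
  · intro h
    refine ⟨0, ?_⟩
    rw [pow_zero, one_mulVec]
    exact (norm_mulVec_le hS _).trans h

theorem powerBounded_one {p : ℕ} [Fact p.Prime] :
    PowerBounded (1 : Matrix (Fin n) (Fin n) ℚ_[p]) :=
  ⟨1, zero_le_one, fun k x => by simp⟩

/-- The local comparison of the groups of `A` and of `M`: at every prime they agree up to a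
scalar. -/
theorem exists_padic_scalar (A B : Matrix (Fin n) (Fin n) ℤ) (hirr : Irreducible A.charpoly)
    (ht : ∀ p ∈ primesP' A, multZero A p = n - 1)
    {p : ℕ} [Fact p.Prime] (hAB : (p : ℤ) ∣ B.det → (p : ℤ) ∣ A.det)
    {M S S' C D : Matrix (Fin n) (Fin n) ℚ_[p]}
    (hSS' : S' * S = 1) (hSM : S * M = matOver ℚ_[p] B * S)
    (hS : ¬ (p : ℤ) ∣ A.det → (∀ i j, ‖S i j‖ ≤ 1) ∧ ∀ i j, ‖S' i j‖ ≤ 1)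
    (hAD : Commute (matOver ℚ_[p] A) D) (hMC : Commute M C) {r s : ℕ}
    (hr : M ^ r = matOver ℚ_[p] A * D) (hs : matOver ℚ_[p] A ^ s = M * C)
    (hC : PowerBounded C) (hD : PowerBounded D) :
    ∃ m : ℤ, (¬ (p : ℤ) ∣ A.det → m = 0) ∧ ∀ q : ℚ_[p], ‖q‖ = (p : ℝ) ^ m →
      ∀ x, q • x ∈ padicOrbit S M ↔ x ∈ padicOrbit 1 (matOver ℚ_[p] A) := by
  by_cases hp : (p : ℤ) ∣ A.det
  · obtain ⟨P, c, hc, -, hAP, hPA, hk, -⟩ := exists_rational_projection A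
      (pos_of_irreducible_charpoly A hirr) hp (ht p)
    let i₀ : Fin n := ⟨0, pos_of_irreducible_charpoly A hirr⟩
    -- One coordinate detects `P x`, since `A (P x) = c (P x)` and a nonzero eigenvector has no zero
    -- coordinate.
    let φ : (Fin n → ℚ_[p]) →ₗ[ℚ_[p]] ℚ_[p] := LinearMap.proj i₀ ∘ₗ Matrix.toLin' P
    have hφx : ∀ x, φ x = (P *ᵥ x) i₀ := fun _ => rfl
    have hφ : ∀ x, φ x = 0 ↔ P *ᵥ x = 0 := fun x => by
      refine ⟨fun h => eigenvector_eq_zero A hirr (c := c) ?_ i₀ h, fun h => by rw [hφx, h]; rfl⟩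
      rw [mulVec_mulVec, hAP, smul_mulVec]
    have hφb : ∀ x, ‖φ x‖ ≤ ‖P *ᵥ x‖ := fun x => norm_le_pi_norm (P *ᵥ x) i₀
    obtain ⟨t, h1⟩ := exists_padicOrbit_iff hc hPA hk hSS' hSM (norm_matOver_le p B) hAD hMC hr hs
      hC hD φ hφ hφb
    -- The group of `A` itself is the case of trivial `S`, `C`, `D`. Both groups are balls for the
    -- same `φ`, so scaling by norm `p ^ (t - t')` carries one to the other.
    obtain ⟨t', h2⟩ := exists_padicOrbit_iff (M := matOver ℚ_[p] A) (S := 1) (S' := 1) (C := 1)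
      (D := 1) (r := 1) (s := 1) hc hPA hk (one_mul 1) (by rw [one_mul, mul_one])
      (norm_matOver_le p A) (Commute.one_right _) (Commute.one_right _) (by simp) (by simp)
      powerBounded_one powerBounded_one φ hφ hφb
    refine ⟨t - t', fun h => absurd hp h, fun q hq x => ?_⟩
    have hp0 : (0 : ℝ) < p := by exact_mod_cast (Fact.out : p.Prime).pos
    rw [h1, h2, map_smul, smul_eq_mul, norm_mul, hq, zpow_sub₀ hp0.ne', div_mul_eq_mul_div,
      div_le_iff₀ (by positivity)]
    exact mul_le_mul_iff_right₀ (by positivity)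
  · refine ⟨0, fun _ => rfl, fun q hq x => ?_⟩
    rw [zpow_zero] at hq
    rw [padicOrbit_smul_iff hq,
      mem_padicOrbit_iff_of_not_dvd B (fun h => hp (hAB h)) (hS hp).1 (hS hp).2 hSS' hSM,
      mem_padicOrbit_iff_of_not_dvd A hp (S' := 1) ?_ ?_ (one_mul 1) (by rw [one_mul, mul_one])]
    all_goals
      intro i j
      rw [Matrix.one_apply]
      split_ifs <;> simp

section

variable {K : Type*} [Field K] [CharZero K] (A : Matrix (Fin n) (Fin n) ℤ)

theorem eq_of_mulVec_eigenvector (hirr : Irreducible A.charpoly) {a : K} {u : Fin n → K}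
    (hu : u ≠ 0) (hA : matOver K A *ᵥ u = a • u) {M M' : Matrix (Fin n) (Fin n) ℚ}
    (h : castMat K M *ᵥ u = castMat K M' *ᵥ u) : M = M' := by
  rw [← sub_eq_zero]
  apply matrix_eq_zero_of_mulVec_eigenvector A hirr hu hA
  change castMat K (M - M') *ᵥ u = 0
  rw [map_sub, sub_mulVec, h, sub_self]

theorem commute_of_mulVec_eigenvector (hirr : Irreducible A.charpoly) {a : K} {u : Fin n → K}
    (hu : u ≠ 0) (hA : matOver K A *ᵥ u = a • u) {M M' : Matrix (Fin n) (Fin n) ℚ} {b c : K}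
    (h : castMat K M *ᵥ u = b • u) (h' : castMat K M' *ᵥ u = c • u) : Commute M M' := by
  apply eq_of_mulVec_eigenvector A hirr hu hA
  rw [map_mul, map_mul, ← mulVec_mulVec, ← mulVec_mulVec, h, h', mulVec_smul, mulVec_smul, h, h',
    smul_comm]

theorem castMat_pow_mulVec {u : Fin n → K} {M : Matrix (Fin n) (Fin n) ℚ} {b : K}
    (h : castMat K M *ᵥ u = b • u) (k : ℕ) : castMat K (M ^ k) *ᵥ u = b ^ k • u := by
  induction k with
  | zero => simp
  | succ k ih =>
    rw [pow_succ', map_mul, ← mulVec_mulVec, ih, mulVec_smul, h, smul_smul, pow_succ]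

/-- A monic integer relation for the eigenvalue `c` holds for `C` itself, because a rational matrix
is determined by its value at `u`. -/
theorem exists_common_denominator_of_isIntegral (hirr : Irreducible A.charpoly) {a : K}
    {u : Fin n → K} (hu : u ≠ 0) (hA : matOver K A *ᵥ u = a • u)
    {C : Matrix (Fin n) (Fin n) ℚ} {c : K} (h : castMat K C *ᵥ u = c • u) (hc : IsIntegral ℤ c) :
    ∃ N : ℕ, N ≠ 0 ∧ ∀ k : ℕ, ∃ Z : Matrix (Fin n) (Fin n) ℤ,
      (N : ℚ) • C ^ k = matOver ℚ Z := by
  obtain ⟨g, hg, hgc⟩ := hc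
  refine exists_common_denominator_pow C g hg ?_
  apply eq_of_mulVec_eigenvector A hirr hu hA
  have key : ∀ g : ℤ[X], castMat K (aeval C g) *ᵥ u = aeval c g • u := by
    intro g
    induction g using Polynomial.induction_on' with
    | add p q hp hq => rw [map_add, map_add, add_mulVec, hp, hq, map_add, add_smul]
    | monomial k z =>
      rw [aeval_monomial, aeval_monomial, map_mul, eq_intCast, eq_intCast, map_intCast,
        ← mulVec_mulVec, castMat_pow_mulVec h, mul_smul]
      ext i
      simp
  rw [key, map_zero, zero_mulVec]
  rw [← aeval_def] at hgc
  rw [hgc, zero_smul]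

end

variable {K : Type*} [Field K] [NumberField K]

theorem nonempty_addEquiv_of_eigenvalues (A B : Matrix (Fin n) (Fin n) ℤ)
    (hA : A.det ≠ 0) (hB : B.det ≠ 0) (hirr : Irreducible A.charpoly)
    (ht : ∀ p ∈ primesP' A, multZero A p = n - 1) (a b : 𝓞 K) (hab : SamePrimeIdealDivisors a b)
    (hI : SameIdealClass A B (a : K) (b : K)) : Nonempty (groupG A hA ≃+ groupG B hB) := by
  obtain ⟨u, v, ⟨heA, -⟩, ⟨heB, -⟩, y, hy, hset⟩ := hI
  obtain ⟨hAu, hu⟩ := (hasEigenvector_matOver_iff A _ u).mp heA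
  obtain ⟨hBv, hv⟩ := (hasEigenvector_matOver_iff B _ v).mp heB
  have hself : ∀ (C : Matrix (Fin n) (Fin n) ℤ) (w : Fin n → K) i, w i ∈ idealR C w :=
    fun C w i => (mem_idealR_iff C w _).mpr ⟨Pi.single i 1, fun j => by
      by_cases hij : j = i
      · subst hij; simp [one_mem]
      · simp [hij, zero_mem], by
      rw [Finset.sum_eq_single i]
      · simp
      · intro j _ hj; simp [hj]
      · simp⟩
  obtain ⟨S, hSR, hS⟩ : ∃ S : Matrix (Fin n) (Fin n) ℚ, (∀ i j, S i j ∈ ringR A) ∧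
      y • v = castMat K S *ᵥ u := by
    have : ∀ i, y * v i ∈ idealR A u := fun i => by
      have : y * v i ∈ (idealR A u : Set K) := hset ▸ ⟨v i, hself B v i, rfl⟩
      exact this
    simp only [mem_idealR_iff] at this
    choose S hS using this
    refine ⟨Matrix.of S, fun i => (hS i).1, ?_⟩
    ext i
    rw [Pi.smul_apply, smul_eq_mul, (hS i).2]
    simp [mulVec, dotProduct, castMat_apply]
  obtain ⟨S', hSR', hS'⟩ : ∃ S' : Matrix (Fin n) (Fin n) ℚ, (∀ i j, S' i j ∈ ringR B) ∧
      u = castMat K S' *ᵥ (y • v) := by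
    have : ∀ i, ∃ x ∈ idealR B v, y * x = u i := fun i => by
      have : u i ∈ (fun x => y * x) '' (idealR B v : Set K) := hset ▸ hself A u i
      exact this
    simp only [mem_idealR_iff] at this
    choose x hx hxu using this
    choose S' hS' using hx
    refine ⟨Matrix.of S', fun i => (hS' i).1, ?_⟩
    ext i
    rw [← hxu, (hS' i).2, mulVec_smul]
    simp [mulVec, dotProduct, castMat_apply]
  have hS'S : S' * S = 1 := by
    apply eq_of_mulVec_eigenvector A hirr hu hAu
    rw [map_mul, ← mulVec_mulVec, ← hS, ← hS', map_one, one_mulVec]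
  have hSS' : S * S' = 1 := mul_eq_one_comm.mp hS'S
  -- `M` is `B` transported to the coordinates of `A`; it has the eigenvector `u` with eigenvalue
  -- `b`.
  set M := S' * matOver ℚ B * S with hM
  have hSM : S * M = matOver ℚ B * S := by
    rw [hM, ← mul_assoc, ← mul_assoc, hSS', one_mul]
  have hMu : castMat K M *ᵥ u = (b : K) • u := by
    rw [hM, map_mul, map_mul, castMat_matOver, ← mulVec_mulVec, ← mulVec_mulVec, ← hS,
      mulVec_smul _ y, hBv, smul_comm, mulVec_smul, ← hS']
  have hAu' : castMat K (matOver ℚ A) *ᵥ u = (a : K) • u := by rw [castMat_matOver, hAu]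
  have hMdet : M.det = B.det := by
    have h1 := congrArg Matrix.det hS'S
    rw [det_mul, det_one] at h1
    rw [hM, det_mul, det_mul, det_matOver]
    linear_combination (B.det : ℚ) * h1
  have hMu' : IsUnit M.det := by
    rw [hMdet, isUnit_iff_ne_zero]
    exact_mod_cast hB
  have hAunit := isUnit_det_matOver A hA
  -- Lifts a divisibility of eigenvalues to a factorisation of matrices sharing the eigenvector `u`.
  have hquot : ∀ {M M' : Matrix (Fin n) (Fin n) ℚ} {a b c : 𝓞 K} {k : ℕ}, IsUnit M'.det →
      castMat K M *ᵥ u = (a : K) • u → castMat K M' *ᵥ u = (b : K) • u → a ^ k = b * c →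
      ∃ C : Matrix (Fin n) (Fin n) ℚ, M ^ k = M' * C ∧ castMat K C *ᵥ u = (c : K) • u := by
    intro M M' a b c k hdet h h' hk
    refine ⟨M'⁻¹ * M ^ k, by rw [← mul_assoc, mul_nonsing_inv _ hdet, one_mul], ?_⟩
    have hk' : (a : K) ^ k = (b : K) * (c : K) := by
      have := congrArg (algebraMap (𝓞 K) K) hk
      rwa [map_pow, map_mul] at this
    rw [map_mul, ← mulVec_mulVec, castMat_pow_mulVec h, hk', mul_comm, mul_smul, ← h',
      mulVec_smul, mulVec_mulVec, ← map_mul, nonsing_inv_mul _ hdet, map_one, one_mulVec]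
  have hne : ∀ {M : Matrix (Fin n) (Fin n) ℚ} {a : 𝓞 K}, IsUnit M.det →
      castMat K M *ᵥ u = (a : K) • u → a ≠ 0 := by
    rintro M a hdet h rfl
    apply hu
    rw [← one_mulVec u, ← map_one (castMat K), ← nonsing_inv_mul _ hdet, map_mul, ← mulVec_mulVec, h]
    simp
  obtain ⟨s, c, hc⟩ := exists_dvd_pow_of_samePrimeIdealDivisors (hne hMu' hMu) hab
  obtain ⟨r, d, hd⟩ := exists_dvd_pow_of_samePrimeIdealDivisors (hne hAunit hAu')
    fun P hP hP0 => (hab P hP hP0).symm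
  obtain ⟨C, hAs, hCu⟩ := hquot hMu' hAu' hMu hc
  obtain ⟨D, hMr, hDu⟩ := hquot hAunit hMu hAu' hd
  have hMC : Commute M C := commute_of_mulVec_eigenvector A hirr hu hAu hMu hCu
  have hAD : Commute (matOver ℚ A) D := commute_of_mulVec_eigenvector A hirr hu hAu hAu' hDu
  obtain ⟨NC, hNC0, hNC⟩ := exists_common_denominator_of_isIntegral A hirr hu hAu hCu c.2
  obtain ⟨ND, hND0, hND⟩ := exists_common_denominator_of_isIntegral A hirr hu hAu hDu d.2
  have hdvd : ∀ p : ℕ, p.Prime → (p : ℤ) ∣ B.det → (p : ℤ) ∣ A.det := fun p hp =>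
    dvd_det_of_pow_eq hp B A (matOver ℚ A) M C (det_matOver A) hMdet hMC hAs NC hNC0 hNC
  -- The exponent is zero away from the primes dividing `det A`, so a single rational `z` can
  -- realise all the local scalars; then `z S` is the required isomorphism.
  have hlocal : ∀ p : ℕ, ∃ m : ℤ, (p ∉ A.det.natAbs.primeFactors → m = 0) ∧ ∀ [Fact p.Prime],
      ∀ q : ℚ_[p], ‖q‖ = (p : ℝ) ^ m → ∀ x,
        q • x ∈ padicOrbit (castMat ℚ_[p] S) (castMat ℚ_[p] M) ↔
          x ∈ padicOrbit 1 (matOver ℚ_[p] A) := by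
    intro p
    by_cases hp : p.Prime
    · have : Fact p.Prime := ⟨hp⟩
      obtain ⟨m, hm, h⟩ := exists_padic_scalar (p := p) A B hirr ht (hdvd p hp)
        (S := castMat ℚ_[p] S) (S' := castMat ℚ_[p] S') (M := castMat ℚ_[p] M)
        (C := castMat ℚ_[p] C) (D := castMat ℚ_[p] D)
        (by rw [← map_mul, hS'S, map_one])
        (by rw [← map_mul, hSM, map_mul, castMat_matOver])
        (fun hpA => ⟨fun i j => by
          rw [castMat_apply]; exact norm_le_one_of_mem_ringR p A hA hpA (hSR i j), fun i j => by
          rw [castMat_apply]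
          exact norm_le_one_of_mem_ringR p B hB (fun h => hpA (hdvd p hp h)) (hSR' i j)⟩)
        (by rw [← castMat_matOver]; exact hAD.map (castMat ℚ_[p]))
        (hMC.map (castMat ℚ_[p]))
        (by rw [← map_pow, hMr, map_mul, castMat_matOver])
        (by rw [← castMat_matOver, ← map_pow, hAs, map_mul])
        (powerBounded_castMat p C NC hNC0 hNC) (powerBounded_castMat p D ND hND0 hND)
      refine ⟨m, fun hpm => hm fun hpA => hpm ?_, fun {_} => h⟩
      exact Nat.mem_primeFactors.mpr ⟨hp, Int.natCast_dvd.mp hpA, Int.natAbs_ne_zero.mpr hA⟩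
    · exact ⟨0, fun _ => rfl, fun {hp'} => absurd hp'.out hp⟩
  choose m hm hloc using hlocal
  obtain ⟨z, hz0, hz⟩ := exists_rat_padic_norm_eq A.det.natAbs.primeFactors m hm
    fun p hp => Nat.prime_of_mem_primeFactors hp
  refine nonempty_addEquiv_of_mem_iff A B hA hB (T := z • S) (T' := z⁻¹ • S') ?_ fun x => ?_
  · rw [smul_mul_smul_comm, inv_mul_cancel₀ hz0, one_smul, hS'S]
  rw [mem_groupG_iff_padic, mem_groupG_iff_padic]
  refine forall_congr' fun p => forall_congr' fun hp => ?_
  have h1 := hloc p (z : ℚ_[p]) (hz p) (castVec ℚ_[p] x)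
  have h2 : castVec ℚ_[p] ((z • S) *ᵥ x) = castMat ℚ_[p] S *ᵥ ((z : ℚ_[p]) • castVec ℚ_[p] x) := by
    rw [smul_mulVec, mulVec_smul, ← castVec_mulVec]
    ext i
    simp [castVec]
  have h3 : ∀ k, matOver ℚ_[p] B ^ k * castMat ℚ_[p] S = castMat ℚ_[p] S * castMat ℚ_[p] M ^ k := by
    intro k
    have h4 : SemiconjBy S M (matOver ℚ B) := hSM
    have := congrArg (castMat ℚ_[p]) (h4.pow_right k).eq
    rw [map_mul, map_mul, map_pow, map_pow, castMat_matOver] at this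
    exact this.symm
  simp only [padicOrbit, Set.mem_ofPred_eq, one_mulVec] at h1
  rw [← h1, h2]
  refine exists_congr fun k => ?_
  rw [mulVec_mulVec, ← h3, ← mulVec_mulVec]

end

theorem lemma5p10 {n : ℕ} (A B : Matrix (Fin n) (Fin n) ℤ)
    (hA : A.det ≠ 0) (hB : B.det ≠ 0)
    (hAirr : Irreducible A.charpoly) (hBirr : Irreducible B.charpoly)
    (hP' : (primesP' A).Nonempty)
    (ht : ∀ p ∈ primesP' A, multZero A p = n - 1)
    (K : Type*) [Field K] [NumberField K]
    (hKA : (A.charpoly.map (Int.castRingHom K)).Splits)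
    (hKB : (B.charpoly.map (Int.castRingHom K)).Splits) :
    Nonempty (groupG A hA ≃+ groupG B hB) ↔
      ∃ a b : 𝓞 K,
        Module.End.HasEigenvalue (Matrix.toLin' (matOver K A)) (a : K) ∧
        Module.End.HasEigenvalue (Matrix.toLin' (matOver K B)) (b : K) ∧
        SamePrimeIdealDivisors a b ∧
        SameIdealClass A B (a : K) (b : K) := by
  constructor
  · rintro ⟨e⟩
    obtain ⟨p, hp⟩ := hP'
    exact exists_eigenvalues_of_addEquiv A B hA hB hAirr hBirr hp (ht p hp) hKA e
  · rintro ⟨a, b, -, -, hab, hI⟩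
    exact nonempty_addEquiv_of_eigenvalues A B hA hB hAirr ht a b hab hI
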